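/- **Global section functor.** Conventions: $k$ ranges over two symbols $0,1$, so that $\mathsf k$ stands for $\mathsf 0,\mathsf 1$. *CwFs with $\forall$.* We work with categories with families (CwFs): sets of contexts, substitutions $\mathsf{Sub}\,\Delta\,\Gamma$, types $\mathsf{Ty}\,\Gamma$ and terms $\mathsf{Tm}\,\Gamma\,A$, forming a category with terminal context $\diamond$ (with $\epsilon:\mathsf{Sub}\,\Gamma\,\diamond$), functorial instantiation $A[\sigma]$, $t[\sigma]$, and context extension $\Gamma\triangleright A$ with $\mathsf p$, $\mathsf q$ and pairing $(\sigma,t)$. A *CwF with $\forall$* is a CwF with a strict CwF endomorphism $\forall$ (acting on contexts, substitutions, types and terms, preserving $\mathsf{id},\circ$, instantiation, $\diamond$, $\triangleright$, $\mathsf p,\mathsf q$ on the nose) and natural transformations $\mathsf k_\Gamma:\mathsf{Sub}\,(\forall\Gamma)\,\Gamma$ (for $k=0,1$), $\mathsf R_\Gamma:\mathsf{Sub}\,\Gamma\,(\forall\Gamma)$, $\mathsf S_\Gamma:\mathsf{Sub}\,(\forall\forall\Gamma)\,(\forall\forall\Gamma)$ with $$\mathsf k_\Gamma\circ\mathsf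 R_\Gamma=\mathsf{id},\quad \mathsf k_{\forall\Gamma}\circ\mathsf S_\Gamma=\forall\mathsf k_\Gamma,\quad \mathsf S_\Gamma\circ\mathsf R_{\forall\Gamma}=\forall\mathsf R_\Gamma,\quad \mathsf S_\Gamma\circ\mathsf S_\Gamma=\mathsf{id},$$ $$\mathsf S_{\forall\Gamma}\circ\forall\mathsf S_\Gamma\circ\mathsf S_{\forall\Gamma}=\forall\mathsf S_\Gamma\circ\mathsf S_{\forall\Gamma}\circ\forall\mathsf S_\Gamma .$$ For a type $A$ in context $\Gamma$ write $\mathsf k_A:=\mathsf q[\mathsf k_{\Gamma\triangleright A}]$, a term in context $\forall(\Gamma\triangleright A)=\forall\Gamma\triangleright\forall A$. *Models of the global theory.* A model $\mathcal C$ of the global theory is a CwF with $\forall$ in which every type has a level (from a join-semilattice with bottom, with a function $\mathrm{next}$; e.g. $\mathbb N$ with successor, or a one-point set for a presentation without level indices), equipped with: a unit type $\top$ and $\Sigma$-types with $\eta$; strict identity types $\mathsf{Eq}$ with reflection and uniqueness of identity proofs; strict democracy, that is, types $\mathsf K\,\Theta$ with $\mathsf{Sub}\,\Gamma\,\Theta=\mathsf{Tm}\,\Gamma\,(\mathsf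 K\,\Theta)$ (composition being instantiation), $\mathsf K\,\diamond=\top$, and $\mathsf K(\Theta\triangleright A)=\Sigma\,(\mathsf K\,\Theta)\,(A[\mathsf q])$, the pairing for $\triangleright$ being that of $\Sigma$; $\Pi$-types with $\beta$ and $\eta$; Coquand universes $\mathsf U$, with codes in $\mathsf U_i$ in bijection through $\mathsf{El}$ with the types of level $i$; and $\mathsf{Bool}$ with dependent elimination; all stable under substitution. Moreover $\forall$ preserves levels and strictly preserves $\top,\Sigma,\mathsf{Eq},\mathsf K,\mathsf{Bool}$ with their operations, and there are operations, stable under substitution, as follows. * For $\sigma:\mathsf{Sub}\,\Delta\,(\forall\Gamma)$, terms $t_k:\mathsf{Tm}\,\Delta\,((\Pi\,A\,B)[\mathsf k_\Gamma\circ\sigma])$ for $k=0,1$, and $t:\mathsf{Tm}\,\Delta\,((\Pi\,(\forall A)\,(\forall B))[\sigma])$ such that $t_k[\mathsf p]$ applied to $\mathsf k_A[\sigma{\uparrow}]$ equals $\mathsf k_B[\sigma{\uparrow},\mathsf{app}\,t]$ for both $k$, a term $\mathsf{mk}\forall\Pi : \mathsf{Tm}\,\Delta\,((\forall(\Pi\,A\,B))[\sigma])$.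 It is inverse to $t_2\mapsto\big(\mathsf k_{\Pi AB}[\sigma,t_2],\ (\mathsf{lam}\,(\forall(\mathsf{app}\,\mathsf q)))[\sigma,t_2]\big)$. * For types $A_0,A_1,A$ of level $i$ in $\Gamma$ and $t_k:\mathsf{Tm}\,(\Gamma\triangleright A)\,(A_k[\mathsf p])$, a term $\mathsf{unspan}:\mathsf{Tm}\,\Gamma\,((\forall\mathsf U_i)[\epsilon])$ with $(\mathsf{El}\,\mathsf k_{\mathsf U})[\epsilon,\mathsf{unspan}]=A_k$, $(\forall(\mathsf{El}\,\mathsf q))[\epsilon,\mathsf{unspan}]=A$ and $\mathsf k_{\mathsf{El}\,\mathsf q}[(\epsilon,\mathsf{unspan}){\uparrow}]=t_k$. *Cubes.* The BCH cube category $\square$ has objects the natural numbers. Its morphisms are freely generated by $\mathsf{id}$, composition, $\mathsf{suc}\,f:\square(J+1,I+1)$ for $f:\square(J,I)$, $k_I:\square(I,I+1)$ (for $k=0,1$), $R_I:\square(I+1,I)$ and $S_I:\square(I+2,I+2)$, subject to the category laws, functoriality of $\mathsf{suc}$, the naturality equations $$k_I\circ f=\mathsf{suc}\,f\circ k_J,\qquad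 R_I\circ\mathsf{suc}\,f=f\circ R_J,\qquad S_I\circ\mathsf{suc}(\mathsf{suc}\,f)=\mathsf{suc}(\mathsf{suc}\,f)\circ S_J$$ for $f:\square(J,I)$, and $$R_I\circ k_I=\mathsf{id},\quad S_I\circ k_{I+1}=\mathsf{suc}\,k_I,\quad R_{I+1}\circ S_I=\mathsf{suc}\,R_I,\quad S_I\circ S_I=\mathsf{id},$$ $$S_{I+1}\circ\mathsf{suc}\,S_I\circ S_{I+1}=\mathsf{suc}\,S_I\circ S_{I+1}\circ\mathsf{suc}\,S_I .$$ $\mathsf{PSh}(\square)$ is the CwF of presheaves on $\square$ (types are dependent presheaves, terms are dependent natural transformations, extension is the presheaf of pairs). There $\forall$ is precomposition with $\mathsf{suc}$, and $\mathsf k,\mathsf R,\mathsf S$ at $\Gamma$ are restriction along $k_I,R_I,S_I$; with these it is a CwF with $\forall$. *Weak morphisms.* A weak morphism $F$ consists of four maps, on contexts, substitutions, types and terms. It preserves $\mathsf{id}$ and $\circ$, satisfies $F(A[\sigma])=F A[F\sigma]$ and $F(t[\sigma])=F t[F\sigma]$ strictly, the comparison maps $\epsilon:\mathsf{Sub}\,(F\diamond)\,\diamond$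 and $(F\mathsf p,F\mathsf q):\mathsf{Sub}\,(F(\Gamma\triangleright A))\,(F\Gamma\triangleright FA)$ are invertible, and it strictly preserves $\forall$ on contexts, substitutions, types and terms, as well as $\mathsf k$, $\mathsf R$ and $\mathsf S$. (This refers only to the structure of a CwF with $\forall$.) **Statement.** Let $\mathcal C$ be any model of the global theory; in particular $\mathcal C$ may be the syntax, i.e. the initial model. Write $\forall^0\Gamma=\Gamma$, $\forall^{n+1}\Gamma=\forall^n(\forall\Gamma)$, and similarly for substitutions, types and terms. Then the clauses $$\ulcorner f\circ g\urcorner_\Gamma=\ulcorner g\urcorner_\Gamma\circ\ulcorner f\urcorner_\Gamma,\quad \ulcorner\mathsf{id}\urcorner_\Gamma=\mathsf{id},\quad \ulcorner\mathsf{suc}\,f\urcorner_\Gamma=\ulcorner f\urcorner_{\forall\Gamma},\quad \ulcorner k_I\urcorner_\Gamma=\forall^I\mathsf k_\Gamma,\quad \ulcorner R_I\urcorner_\Gamma=\forall^I\mathsf R_\Gamma,\quad \ulcorner S_I\urcorner_\Gamma=\forall^I\mathsf S_\Gamma$$ give a well-defined interpretation of each $f:\square(J,I)$ as substitutions $\ulcorner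 f\urcorner_\Gamma:\mathsf{Sub}\,(\forall^I\Gamma)\,(\forall^J\Gamma)$, natural in $\Gamma$: $\ulcorner f\urcorner_\Gamma\circ\forall^I\sigma=\forall^J\sigma\circ\ulcorner f\urcorner_\Delta$ for every $\sigma:\mathsf{Sub}\,\Delta\,\Gamma$. Moreover, the maps $$\mathsf G\,\Gamma\,I=\mathsf{Sub}\,\diamond\,(\forall^I\Gamma),\qquad \gamma[f]_{\mathsf G\Gamma}=\ulcorner f\urcorner_\Gamma\circ\gamma,\qquad \mathsf G\,\sigma\,\delta=\forall^I\sigma\circ\delta,$$ $$\mathsf G\,A\,I\,\gamma=\mathsf{Tm}\,\diamond\,\big((\forall^I A)[\gamma]\big),\qquad a[f]_{\mathsf GA}=\mathsf q\big[\ulcorner f\urcorner_{\Gamma\triangleright A}\circ(\gamma,a)\big],\qquad \mathsf G\,t\,\gamma=(\forall^I t)[\gamma]$$ form a weak morphism $\mathsf G$ from $\mathcal C$ to $\mathsf{PSh}(\square)$. -/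

import Mathlib

open CategoryTheory Opposite

universe u v u' v'

namespace IntParam

/-- Categories with families. `Sub Δ Γ` are the substitutions from `Δ` to `Γ`, `sTy A σ` and
`sTm t σ` are the instantiations `A[σ]` and `t[σ]`, `ext Γ A` is `Γ ▷ A`. Equations between terms
whose types are only provably equal are stated with `HEq`. -/
structure CwF where
  Con : Type u
  Sub : Con → Con → Type v
  Ty : Con → Type u
  Tm : (Γ : Con) → Ty Γ → Type v
  id : (Γ : Con) → Sub Γ Γ
  comp : {Θ Δ Γ : Con} → Sub Δ Γ → Sub Θ Δ → Sub Θ Γ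
  id_comp : ∀ {Δ Γ : Con} (σ : Sub Δ Γ), comp (id Γ) σ = σ
  comp_id : ∀ {Δ Γ : Con} (σ : Sub Δ Γ), comp σ (id Δ) = σ
  assoc : ∀ {Ξ Θ Δ Γ : Con} (σ : Sub Δ Γ) (ρ : Sub Θ Δ) (τ : Sub Ξ Θ),
    comp (comp σ ρ) τ = comp σ (comp ρ τ)
  emp : Con
  eps : (Γ : Con) → Sub Γ emp
  eps_eta : ∀ {Γ : Con} (σ : Sub Γ emp), σ = eps Γ
  sTy : {Δ Γ : Con} → Ty Γ → Sub Δ Γ → Ty Δ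
  sTy_id : ∀ {Γ : Con} (A : Ty Γ), sTy A (id Γ) = A
  sTy_comp : ∀ {Θ Δ Γ : Con} (A : Ty Γ) (σ : Sub Δ Γ) (ρ : Sub Θ Δ),
    sTy A (comp σ ρ) = sTy (sTy A σ) ρ
  sTm : {Δ Γ : Con} → {A : Ty Γ} → Tm Γ A → (σ : Sub Δ Γ) → Tm Δ (sTy A σ)
  sTm_id : ∀ {Γ : Con} {A : Ty Γ} (t : Tm Γ A), HEq (sTm t (id Γ)) t
  sTm_comp : ∀ {Θ Δ Γ : Con} {A : Ty Γ} (t : Tm Γ A) (σ : Sub Δ Γ) (ρ : Sub Θ Δ),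
    HEq (sTm t (comp σ ρ)) (sTm (sTm t σ) ρ)
  ext : (Γ : Con) → Ty Γ → Con
  p : {Γ : Con} → (A : Ty Γ) → Sub (ext Γ A) Γ
  q : {Γ : Con} → (A : Ty Γ) → Tm (ext Γ A) (sTy A (p A))
  pair : {Δ Γ : Con} → {A : Ty Γ} → (σ : Sub Δ Γ) → Tm Δ (sTy A σ) → Sub Δ (ext Γ A)
  p_pair : ∀ {Δ Γ : Con} {A : Ty Γ} (σ : Sub Δ Γ) (t : Tm Δ (sTy A σ)),
    comp (p A) (pair σ t) = σ
  q_pair : ∀ {Δ Γ : Con} {A : Ty Γ} (σ : Sub Δ Γ) (t : Tm Δ (sTy A σ)),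
    HEq (sTm (q A) (pair σ t)) t
  pair_eta : ∀ {Δ Γ : Con} {A : Ty Γ} (τ : Sub Δ (ext Γ A)),
    pair (comp (p A) τ) (cast (congrArg (Tm Δ) (sTy_comp A (p A) τ).symm) (sTm (q A) τ)) = τ

namespace CwF

variable (C : CwF.{u, v})

/-- Transport of a term along an equality of types. -/
def coe {Γ : C.Con} {A B : C.Ty Γ} (h : A = B) (t : C.Tm Γ A) : C.Tm Γ B :=
  cast (congrArg (C.Tm Γ) h) t

theorem coe_heq {Γ : C.Con} {A B : C.Ty Γ} (h : A = B) (t : C.Tm Γ A) : HEq (C.coe h t) t :=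
  cast_heq _ _

theorem pair_congr {Δ Γ : C.Con} {A : C.Ty Γ} {σ σ' : C.Sub Δ Γ} (h : σ = σ')
    {t : C.Tm Δ (C.sTy A σ)} {t' : C.Tm Δ (C.sTy A σ')} (ht : HEq t t') :
    C.pair σ t = C.pair σ' t' := by
  subst h; rw [eq_of_heq ht]

/-- Two substitutions into `Γ ▷ A` with the same components are equal. -/
theorem sub_ext {Δ Γ : C.Con} {A : C.Ty Γ} {τ τ' : C.Sub Δ (C.ext Γ A)}
    (h : C.comp (C.p A) τ = C.comp (C.p A) τ')
    (hq : HEq (C.sTm (C.q A) τ) (C.sTm (C.q A) τ')) : τ = τ' := by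
  rw [← C.pair_eta τ, ← C.pair_eta τ']
  exact C.pair_congr h ((cast_heq _ _).trans (hq.trans (cast_heq _ _).symm))

/-- The lifting `σ↑ = (σ ∘ p, q)`. -/
def lift {Δ Γ : C.Con} (σ : C.Sub Δ Γ) (A : C.Ty Γ) :
    C.Sub (C.ext Δ (C.sTy A σ)) (C.ext Γ A) :=
  C.pair (C.comp σ (C.p (C.sTy A σ))) (C.coe (C.sTy_comp A σ _).symm (C.q (C.sTy A σ)))

/-- The substitution `(id, t)`. -/
def sg {Γ : C.Con} {A : C.Ty Γ} (t : C.Tm Γ A) : C.Sub Γ (C.ext Γ A) :=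
  C.pair (C.id Γ) (C.coe (C.sTy_id A).symm t)

end CwF

/-- A CwF with a strict CwF endomorphism `∀` (the maps `aCon`, `aSub`, `aTy`, `aTm`), natural
transformations `k : ∀ ⟶ id` (for the two values `0`, `1` of `k`), `R : id ⟶ ∀`,
`S : ∀ ∘ ∀ ⟶ ∀ ∘ ∀`, and the five equations relating them. Preservation of `ε` and of
`(σ, t)` follows from the uniqueness clauses of a CwF. -/
structure ForallCwF extends CwF.{u, v} where
  aCon : Con → Con
  aSub : {Δ Γ : Con} → Sub Δ Γ → Sub (aCon Δ) (aCon Γ)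
  aTy : {Γ : Con} → Ty Γ → Ty (aCon Γ)
  aTm : {Γ : Con} → {A : Ty Γ} → Tm Γ A → Tm (aCon Γ) (aTy A)
  aSub_id : ∀ Γ : Con, aSub (id Γ) = id (aCon Γ)
  aSub_comp : ∀ {Θ Δ Γ : Con} (σ : Sub Δ Γ) (ρ : Sub Θ Δ),
    aSub (comp σ ρ) = comp (aSub σ) (aSub ρ)
  aTy_s : ∀ {Δ Γ : Con} (A : Ty Γ) (σ : Sub Δ Γ), aTy (sTy A σ) = sTy (aTy A) (aSub σ)
  aTm_s : ∀ {Δ Γ : Con} {A : Ty Γ} (t : Tm Γ A) (σ : Sub Δ Γ),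
    HEq (aTm (sTm t σ)) (sTm (aTm t) (aSub σ))
  aCon_emp : aCon emp = emp
  aCon_ext : ∀ (Γ : Con) (A : Ty Γ), aCon (ext Γ A) = ext (aCon Γ) (aTy A)
  aSub_p : ∀ {Γ : Con} (A : Ty Γ), HEq (aSub (p A)) (p (aTy A))
  aTm_q : ∀ {Γ : Con} (A : Ty Γ), HEq (aTm (q A)) (q (aTy A))
  k : Fin 2 → (Γ : Con) → Sub (aCon Γ) Γ
  k_nat : ∀ (e : Fin 2) {Δ Γ : Con} (σ : Sub Δ Γ), comp (k e Γ) (aSub σ) = comp σ (k e Δ)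
  R : (Γ : Con) → Sub Γ (aCon Γ)
  R_nat : ∀ {Δ Γ : Con} (σ : Sub Δ Γ), comp (R Γ) σ = comp (aSub σ) (R Δ)
  S : (Γ : Con) → Sub (aCon (aCon Γ)) (aCon (aCon Γ))
  S_nat : ∀ {Δ Γ : Con} (σ : Sub Δ Γ),
    comp (S Γ) (aSub (aSub σ)) = comp (aSub (aSub σ)) (S Δ)
  k_R : ∀ (e : Fin 2) (Γ : Con), comp (k e Γ) (R Γ) = id Γ
  k_S : ∀ (e : Fin 2) (Γ : Con), comp (k e (aCon Γ)) (S Γ) = aSub (k e Γ)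
  S_R : ∀ Γ : Con, comp (S Γ) (R (aCon Γ)) = aSub (R Γ)
  S_S : ∀ Γ : Con, comp (S Γ) (S Γ) = id (aCon (aCon Γ))
  S_braid : ∀ Γ : Con,
    comp (S (aCon Γ)) (comp (aSub (S Γ)) (S (aCon Γ))) =
      comp (aSub (S Γ)) (comp (S (aCon Γ)) (aSub (S Γ)))


/-- The type formers `⊤`, `Σ`, `Eq` (strict identity with reflection and uniqueness of identity
proofs), strict democracy `K`, `Π`, Coquand universes and `Bool` on a CwF: a model of the core
theory.

Every type has a level in `L`, so the types of level `i` in context `Γ` are the `A : Ty Γ` with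
`lev A = i`; `U i` classifies them and has itself level `next i`. With `L = ℕ` and `next i = i + 1`
this is the usual hierarchy; with a one-point `L` it is the presentation without level indices. -/
structure CoreModel (L : Type) [SemilatticeSup L] [OrderBot L] (next : L → L)
    extends CwF.{u, v} where
  lev : {Γ : Con} → Ty Γ → L
  lev_s : ∀ {Δ Γ : Con} (A : Ty Γ) (σ : Sub Δ Γ), lev (sTy A σ) = lev A
  -- unit type
  top : (Γ : Con) → Ty Γ
  lev_top : ∀ Γ : Con, lev (top Γ) = ⊥
  top_s : ∀ {Δ Γ : Con} (σ : Sub Δ Γ), sTy (top Γ) σ = top Δ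
  tt : (Γ : Con) → Tm Γ (top Γ)
  top_eta : ∀ {Γ : Con} (t : Tm Γ (top Γ)), t = tt Γ
  -- dependent sums
  sig : {Γ : Con} → (A : Ty Γ) → Ty (ext Γ A) → Ty Γ
  lev_sig : ∀ {Γ : Con} (A : Ty Γ) (B : Ty (ext Γ A)), lev (sig A B) = lev A ⊔ lev B
  sig_s : ∀ {Δ Γ : Con} (A : Ty Γ) (B : Ty (ext Γ A)) (σ : Sub Δ Γ),
    sTy (sig A B) σ = sig (sTy A σ) (sTy B (toCwF.lift σ A))
  spair : {Γ : Con} → {A : Ty Γ} → {B : Ty (ext Γ A)} → (a : Tm Γ A) →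
    Tm Γ (sTy B (toCwF.sg a)) → Tm Γ (sig A B)
  fst : {Γ : Con} → {A : Ty Γ} → {B : Ty (ext Γ A)} → Tm Γ (sig A B) → Tm Γ A
  snd : {Γ : Con} → {A : Ty Γ} → {B : Ty (ext Γ A)} → (t : Tm Γ (sig A B)) →
    Tm Γ (sTy B (toCwF.sg (fst t)))
  fst_spair : ∀ {Γ : Con} {A : Ty Γ} {B : Ty (ext Γ A)} (a : Tm Γ A)
    (b : Tm Γ (sTy B (toCwF.sg a))), fst (spair a b) = a
  snd_spair : ∀ {Γ : Con} {A : Ty Γ} {B : Ty (ext Γ A)} (a : Tm Γ A)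
    (b : Tm Γ (sTy B (toCwF.sg a))), HEq (snd (spair a b)) b
  spair_eta : ∀ {Γ : Con} {A : Ty Γ} {B : Ty (ext Γ A)} (t : Tm Γ (sig A B)),
    spair (fst t) (snd t) = t
  fst_s : ∀ {Δ Γ : Con} {A : Ty Γ} {B : Ty (ext Γ A)} (t : Tm Γ (sig A B)) (σ : Sub Δ Γ),
    sTm (fst t) σ = fst (toCwF.coe (sig_s A B σ) (sTm t σ))
  snd_s : ∀ {Δ Γ : Con} {A : Ty Γ} {B : Ty (ext Γ A)} (t : Tm Γ (sig A B)) (σ : Sub Δ Γ),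
    HEq (sTm (snd t) σ) (snd (toCwF.coe (sig_s A B σ) (sTm t σ)))
  -- strict identity types
  eqt : {Γ : Con} → {A : Ty Γ} → Tm Γ A → Tm Γ A → Ty Γ
  lev_eqt : ∀ {Γ : Con} {A : Ty Γ} (a b : Tm Γ A), lev (eqt a b) = lev A
  eqt_s : ∀ {Δ Γ : Con} {A : Ty Γ} (a b : Tm Γ A) (σ : Sub Δ Γ),
    sTy (eqt a b) σ = eqt (sTm a σ) (sTm b σ)
  refl : {Γ : Con} → {A : Ty Γ} → (a : Tm Γ A) → Tm Γ (eqt a a)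
  reflect : ∀ {Γ : Con} {A : Ty Γ} {a b : Tm Γ A}, Tm Γ (eqt a b) → a = b
  uip : ∀ {Γ : Con} {A : Ty Γ} {a : Tm Γ A} (e : Tm Γ (eqt a a)), e = refl a
  -- strict democracy: `Sub Γ Θ` and `Tm Γ (K Θ)` are the same set, with the same instantiation
  K : (Γ : Con) → Con → Ty Γ
  K_s : ∀ {Δ Γ : Con} (Θ : Con) (σ : Sub Δ Γ), sTy (K Γ Θ) σ = K Δ Θ
  sub_eq_tm : ∀ Γ Θ : Con, Sub Γ Θ = Tm Γ (K Γ Θ)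
  comp_eq_sTm : ∀ {Δ Γ Θ : Con} (τ : Sub Γ Θ) (σ : Sub Δ Γ),
    HEq (comp τ σ) (sTm (cast (sub_eq_tm Γ Θ) τ) σ)
  K_emp : ∀ Γ : Con, K Γ emp = top Γ
  K_ext : ∀ (Γ Θ : Con) (A : Ty Θ),
    K Γ (ext Θ A) = sig (K Γ Θ)
      (sTy A (cast (sub_eq_tm (ext Γ (K Γ Θ)) Θ).symm (toCwF.coe (K_s Θ _) (q (K Γ Θ)))))
  pair_eq_spair : ∀ {Γ Θ : Con} {A : Ty Θ} (σ : Sub Γ Θ) (t : Tm Γ (sTy A σ))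
    (t' : Tm Γ (sTy
      (sTy A (cast (sub_eq_tm (ext Γ (K Γ Θ)) Θ).symm (toCwF.coe (K_s Θ _) (q (K Γ Θ)))))
      (toCwF.sg (cast (sub_eq_tm Γ Θ) σ)))),
    HEq t' t → HEq (pair σ t) (spair (cast (sub_eq_tm Γ Θ) σ) t')
  -- dependent products
  pi : {Γ : Con} → (A : Ty Γ) → Ty (ext Γ A) → Ty Γ
  lev_pi : ∀ {Γ : Con} (A : Ty Γ) (B : Ty (ext Γ A)), lev (pi A B) = lev A ⊔ lev B
  pi_s : ∀ {Δ Γ : Con} (A : Ty Γ) (B : Ty (ext Γ A)) (σ : Sub Δ Γ),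
    sTy (pi A B) σ = pi (sTy A σ) (sTy B (toCwF.lift σ A))
  lam : {Γ : Con} → {A : Ty Γ} → {B : Ty (ext Γ A)} → Tm (ext Γ A) B → Tm Γ (pi A B)
  app : {Γ : Con} → {A : Ty Γ} → {B : Ty (ext Γ A)} → Tm Γ (pi A B) → Tm (ext Γ A) B
  app_lam : ∀ {Γ : Con} {A : Ty Γ} {B : Ty (ext Γ A)} (t : Tm (ext Γ A) B), app (lam t) = t
  lam_app : ∀ {Γ : Con} {A : Ty Γ} {B : Ty (ext Γ A)} (t : Tm Γ (pi A B)), lam (app t) = t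
  lam_s : ∀ {Δ Γ : Con} {A : Ty Γ} {B : Ty (ext Γ A)} (t : Tm (ext Γ A) B) (σ : Sub Δ Γ),
    HEq (sTm (lam t) σ) (lam (sTm t (toCwF.lift σ A)))
  -- universes
  U : (Γ : Con) → L → Ty Γ
  lev_U : ∀ (Γ : Con) (i : L), lev (U Γ i) = next i
  U_s : ∀ {Δ Γ : Con} (i : L) (σ : Sub Δ Γ), sTy (U Γ i) σ = U Δ i
  code : {Γ : Con} → (A : Ty Γ) → Tm Γ (U Γ (lev A))
  El : {Γ : Con} → {i : L} → Tm Γ (U Γ i) → Ty Γ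
  lev_El : ∀ {Γ : Con} {i : L} (a : Tm Γ (U Γ i)), lev (El a) = i
  El_code : ∀ {Γ : Con} (A : Ty Γ), El (code A) = A
  code_El : ∀ {Γ : Con} {i : L} (a : Tm Γ (U Γ i)), HEq (code (El a)) a
  code_s : ∀ {Δ Γ : Con} (A : Ty Γ) (σ : Sub Δ Γ), HEq (sTm (code A) σ) (code (sTy A σ))
  -- booleans
  bool : (Γ : Con) → Ty Γ
  lev_bool : ∀ Γ : Con, lev (bool Γ) = ⊥
  bool_s : ∀ {Δ Γ : Con} (σ : Sub Δ Γ), sTy (bool Γ) σ = bool Δ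
  tru : (Γ : Con) → Tm Γ (bool Γ)
  fls : (Γ : Con) → Tm Γ (bool Γ)
  tru_s : ∀ {Δ Γ : Con} (σ : Sub Δ Γ), HEq (sTm (tru Γ) σ) (tru Δ)
  fls_s : ∀ {Δ Γ : Con} (σ : Sub Δ Γ), HEq (sTm (fls Γ) σ) (fls Δ)
  ite : {Γ : Con} → (P : Ty (ext Γ (bool Γ))) → (t : Tm Γ (bool Γ)) →
    Tm Γ (sTy P (toCwF.sg (tru Γ))) → Tm Γ (sTy P (toCwF.sg (fls Γ))) →
    Tm Γ (sTy P (toCwF.sg t))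
  ite_tru : ∀ {Γ : Con} (P : Ty (ext Γ (bool Γ))) (a : Tm Γ (sTy P (toCwF.sg (tru Γ))))
    (b : Tm Γ (sTy P (toCwF.sg (fls Γ)))), ite P (tru Γ) a b = a
  ite_fls : ∀ {Γ : Con} (P : Ty (ext Γ (bool Γ))) (a : Tm Γ (sTy P (toCwF.sg (tru Γ))))
    (b : Tm Γ (sTy P (toCwF.sg (fls Γ)))), ite P (fls Γ) a b = b
  ite_s : ∀ {Δ Γ : Con} (P : Ty (ext Γ (bool Γ))) (t : Tm Γ (bool Γ))
    (a : Tm Γ (sTy P (toCwF.sg (tru Γ)))) (b : Tm Γ (sTy P (toCwF.sg (fls Γ)))) (σ : Sub Δ Γ)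
    (P' : Ty (ext Δ (bool Δ))) (t' : Tm Δ (bool Δ))
    (a' : Tm Δ (sTy P' (toCwF.sg (tru Δ)))) (b' : Tm Δ (sTy P' (toCwF.sg (fls Δ)))),
    HEq P' (sTy P (toCwF.lift σ (bool Γ))) → HEq t' (sTm t σ) → HEq a' (sTm a σ) →
    HEq b' (sTm b σ) → HEq (sTm (ite P t a b) σ) (ite P' t' a' b')

namespace ForallCwF

variable (C : ForallCwF.{u, v})

/-- `∀B`, for `B` a type in `Γ ▷ A`, seen in the context `∀Γ ▷ ∀A = ∀(Γ ▷ A)`. -/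
def aTyExt {Γ : C.Con} {A : C.Ty Γ} (B : C.Ty (C.ext Γ A)) : C.Ty (C.ext (C.aCon Γ) (C.aTy A)) :=
  cast (congrArg C.Ty (C.aCon_ext Γ A)) (C.aTy B)

theorem aTyExt_heq {Γ : C.Con} {A : C.Ty Γ} (B : C.Ty (C.ext Γ A)) :
    HEq (C.aTyExt B) (C.aTy B) := cast_heq _ _

theorem tm_congr {Γ Γ' : C.Con} (h : Γ = Γ') {A : C.Ty Γ} {A' : C.Ty Γ'} (hA : HEq A A') :
    C.Tm Γ A = C.Tm Γ' A' := by
  subst h; rw [eq_of_heq hA]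

/-- `∀t`, for `t` a term in `Γ ▷ A`, seen in the context `∀Γ ▷ ∀A = ∀(Γ ▷ A)`. -/
def aTmExt {Γ : C.Con} {A : C.Ty Γ} {B : C.Ty (C.ext Γ A)} (t : C.Tm (C.ext Γ A) B) :
    C.Tm (C.ext (C.aCon Γ) (C.aTy A)) (C.aTyExt B) :=
  cast (C.tm_congr (C.aCon_ext Γ A) (C.aTyExt_heq B).symm) (C.aTm t)

/-- A substitution into `∀Γ ▷ ∀A`, seen as a substitution into `∀(Γ ▷ A)`. -/
def toExt {Δ Γ : C.Con} {A : C.Ty Γ} (τ : C.Sub Δ (C.ext (C.aCon Γ) (C.aTy A))) :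
    C.Sub Δ (C.aCon (C.ext Γ A)) :=
  cast (congrArg (C.Sub Δ) (C.aCon_ext Γ A).symm) τ

/-- The term `k_A` instantiated by a substitution `τ` into `∀(Γ ▷ A)`, that is `q[k_{Γ ▷ A} ∘ τ]`. -/
def kTm {Δ Γ : C.Con} (e : Fin 2) (A : C.Ty Γ) (τ : C.Sub Δ (C.aCon (C.ext Γ A))) :
    C.Tm Δ (C.sTy (C.sTy A (C.p A)) (C.comp (C.k e (C.ext Γ A)) τ)) :=
  C.sTm (C.q A) (C.comp (C.k e (C.ext Γ A)) τ)

/-- The empty substitution, seen as a substitution into `∀◇ = ◇`. -/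
def epsAll (Γ : C.Con) : C.Sub Γ (C.aCon C.emp) :=
  cast (congrArg (C.Sub Γ) C.aCon_emp.symm) (C.eps Γ)

end ForallCwF

/-- The operations of both the core theory and the CwF endomorphism `∀`. -/
structure PreGlobalModel (L : Type) [SemilatticeSup L] [OrderBot L] (next : L → L)
    extends CoreModel.{u, v} L next, ForallCwF.{u, v}

namespace PreGlobalModel

variable {L : Type} [SemilatticeSup L] [OrderBot L] {next : L → L}
  (C : PreGlobalModel.{u, v} L next)

/-- Application `f $ a` of a function `f : (Π A B)[τ]` to `a : A[τ]`, where the codomain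
`B[τ, a]` is written `B[τ↑][id, a]`. -/
def appAt {Δ Γ : C.Con} {A : C.Ty Γ} {B : C.Ty (C.ext Γ A)} (τ : C.Sub Δ Γ)
    (f : C.Tm Δ (C.sTy (C.pi A B) τ)) (a : C.Tm Δ (C.sTy A τ)) :
    C.Tm Δ (C.sTy (C.sTy B (C.lift τ A)) (C.sg a)) :=
  C.sTm (C.app (C.coe (C.pi_s A B τ) f)) (C.sg a)

/-- The term `app t : (∀B)[σ↑]` in context `Δ ▷ (∀A)[σ]`, for `t : (Π (∀A) (∀B))[σ]`. -/
def appAll {Δ Γ : C.Con} {A : C.Ty Γ} {B : C.Ty (C.ext Γ A)} (σ : C.Sub Δ (C.aCon Γ))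
    (t : C.Tm Δ (C.sTy (C.pi (C.aTy A) (C.aTyExt B)) σ)) :
    C.Tm (C.ext Δ (C.sTy (C.aTy A) σ)) (C.sTy (C.aTyExt B) (C.lift σ (C.aTy A))) :=
  C.app (C.coe (C.pi_s (C.aTy A) (C.aTyExt B) σ) t)

theorem aTyExt_toExt {Δ Γ : C.Con} {A : C.Ty Γ} (B : C.Ty (C.ext Γ A))
    (τ : C.Sub Δ (C.ext (C.aCon Γ) (C.aTy A))) :
    C.sTy (C.aTyExt B) τ = C.sTy (C.aTy B) (C.toExt τ) := by
  have key : ∀ (X : C.Con) (h : C.aCon (C.ext Γ A) = X) (τ : C.Sub Δ X),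
      C.sTy (cast (congrArg C.Ty h) (C.aTy B)) τ =
        C.sTy (C.aTy B) (cast (congrArg (C.Sub Δ) h.symm) τ) := by
    rintro X rfl τ; rfl
  exact key _ (C.aCon_ext Γ A) τ

/-- The substitution `(σ↑, app t)` from `Δ ▷ (∀A)[σ]` to `∀Γ ▷ ∀A ▷ ∀B = ∀(Γ ▷ A ▷ B)`. -/
def pairAppAll {Δ Γ : C.Con} {A : C.Ty Γ} {B : C.Ty (C.ext Γ A)} (σ : C.Sub Δ (C.aCon Γ))
    (t : C.Tm Δ (C.sTy (C.pi (C.aTy A) (C.aTyExt B)) σ)) :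
    C.Sub (C.ext Δ (C.sTy (C.aTy A) σ)) (C.aCon (C.ext (C.ext Γ A) B)) :=
  C.toExt (C.pair (C.toExt (C.lift σ (C.aTy A)))
    (C.coe (C.aTyExt_toExt B _) (C.appAll σ t)))

/-- `t_k : (Π A B)[k ∘ σ]` (for both `k`) and `t : (Π (∀A) (∀B))[σ]` are compatible:
`t_k[p] $ k_A[σ↑] = k_B[σ↑, app t]`. The variables `f` and `a` stand for `t_k[p]` and `k_A[σ↑]`,
of which the types hold only up to provable equality. -/
def Compatible {Δ Γ : C.Con} {A : C.Ty Γ} {B : C.Ty (C.ext Γ A)} (σ : C.Sub Δ (C.aCon Γ))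
    (tk : (e : Fin 2) → C.Tm Δ (C.sTy (C.pi A B) (C.comp (C.k e Γ) σ)))
    (t : C.Tm Δ (C.sTy (C.pi (C.aTy A) (C.aTyExt B)) σ)) : Prop :=
  ∀ (e : Fin 2)
    (f : C.Tm (C.ext Δ (C.sTy (C.aTy A) σ))
      (C.sTy (C.pi A B) (C.comp (C.comp (C.k e Γ) σ) (C.p (C.sTy (C.aTy A) σ)))))
    (a : C.Tm (C.ext Δ (C.sTy (C.aTy A) σ))
      (C.sTy A (C.comp (C.comp (C.k e Γ) σ) (C.p (C.sTy (C.aTy A) σ))))),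
    HEq f (C.sTm (tk e) (C.p (C.sTy (C.aTy A) σ))) →
    HEq a (C.kTm e A (C.toExt (C.lift σ (C.aTy A)))) →
    HEq (C.appAt _ f a) (C.kTm e B (C.pairAppAll σ t))

/-- The term `lam (∀(app q))[σ, t₂]`, for `t₂ : (∀(Π A B))[σ]`. -/
def lamAllApp {Δ Γ : C.Con} (A : C.Ty Γ) (B : C.Ty (C.ext Γ A)) (σ : C.Sub Δ (C.aCon Γ))
    (t₂ : C.Tm Δ (C.sTy (C.aTy (C.pi A B)) σ)) :=
  C.sTm (C.lam (C.aTmExt (C.app (C.coe (C.pi_s A B (C.p (C.pi A B))) (C.q (C.pi A B))))))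
    (C.toExt (C.pair σ t₂))

/-- The context `◇ ▷ U`. -/
def uCon (i : L) : C.Con := C.ext C.emp (C.U C.emp i)

/-- The substitution `(ε, a)` into `∀(◇ ▷ U)`, for `a : (∀U)[ε]`. -/
def uSub {Γ : C.Con} {i : L} (a : C.Tm Γ (C.sTy (C.aTy (C.U C.emp i)) (C.epsAll Γ))) :
    C.Sub Γ (C.aCon (C.uCon i)) :=
  C.toExt (C.pair (C.epsAll Γ) a)

/-- The type `El q` in context `◇ ▷ U`. -/
def uEl (i : L) : C.Ty (C.uCon i) :=
  C.El (C.coe (C.U_s i (C.p (C.U C.emp i))) (C.q (C.U C.emp i)))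

/-- The type `El k_U` in context `∀(◇ ▷ U)`. -/
def uElk (e : Fin 2) (i : L) : C.Ty (C.aCon (C.uCon i)) :=
  C.El (C.coe ((congrArg (fun X => C.sTy X _) (C.U_s i (C.p (C.U C.emp i)))).trans (C.U_s i _))
    (C.sTm (C.q (C.U C.emp i)) (C.k e (C.uCon i))))

end PreGlobalModel

/-- Models of the global theory. Here `∀` moreover preserves levels, `⊤`, `Σ`, `Eq`, `K` and `Bool`
strictly, `Π` up to an isomorphism with inverse `mkPi`, and `U` up to a section `unspan`.
Preservation of `tt`, `refl` and of pairing is implied by the respective uniqueness rules. -/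
structure GlobalModel (L : Type) [SemilatticeSup L] [OrderBot L] (next : L → L)
    extends PreGlobalModel.{u, v} L next where
  lev_aTy : ∀ {Γ : Con} (A : Ty Γ), lev (aTy A) = lev A
  aTy_top : ∀ Γ : Con, aTy (top Γ) = top (aCon Γ)
  aTy_sig : ∀ {Γ : Con} (A : Ty Γ) (B : Ty (ext Γ A)),
    aTy (sig A B) = sig (aTy A) (toForallCwF.aTyExt B)
  aTm_fst : ∀ {Γ : Con} {A : Ty Γ} {B : Ty (ext Γ A)} (t : Tm Γ (sig A B)),
    aTm (fst t) = fst (toCwF.coe (aTy_sig A B) (aTm t))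
  aTm_snd : ∀ {Γ : Con} {A : Ty Γ} {B : Ty (ext Γ A)} (t : Tm Γ (sig A B)),
    HEq (aTm (snd t)) (snd (toCwF.coe (aTy_sig A B) (aTm t)))
  aTy_eqt : ∀ {Γ : Con} {A : Ty Γ} (a b : Tm Γ A), aTy (eqt a b) = eqt (aTm a) (aTm b)
  aTy_K : ∀ Γ Θ : Con, aTy (K Γ Θ) = K (aCon Γ) (aCon Θ)
  aSub_eq_aTm : ∀ {Γ Θ : Con} (σ : Sub Γ Θ), HEq (aSub σ) (aTm (cast (sub_eq_tm Γ Θ) σ))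
  aTy_bool : ∀ Γ : Con, aTy (bool Γ) = bool (aCon Γ)
  aTm_tru : ∀ Γ : Con, HEq (aTm (tru Γ)) (tru (aCon Γ))
  aTm_fls : ∀ Γ : Con, HEq (aTm (fls Γ)) (fls (aCon Γ))
  aTm_ite : ∀ {Γ : Con} (P : Ty (ext Γ (bool Γ))) (t : Tm Γ (bool Γ))
    (a : Tm Γ (sTy P (toCwF.sg (tru Γ)))) (b : Tm Γ (sTy P (toCwF.sg (fls Γ))))
    (P' : Ty (ext (aCon Γ) (bool (aCon Γ)))) (t' : Tm (aCon Γ) (bool (aCon Γ)))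
    (a' : Tm (aCon Γ) (sTy P' (toCwF.sg (tru (aCon Γ)))))
    (b' : Tm (aCon Γ) (sTy P' (toCwF.sg (fls (aCon Γ))))),
    HEq P' (aTy P) → HEq t' (aTm t) → HEq a' (aTm a) → HEq b' (aTm b) →
    HEq (aTm (ite P t a b)) (ite P' t' a' b')
  mkPi : {Δ Γ : Con} → {A : Ty Γ} → {B : Ty (ext Γ A)} → (σ : Sub Δ (aCon Γ)) →
    (tk : (e : Fin 2) → Tm Δ (sTy (pi A B) (comp (k e Γ) σ))) →
    (t : Tm Δ (sTy (pi (aTy A) (toForallCwF.aTyExt B)) σ)) →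
    toPreGlobalModel.Compatible σ tk t → Tm Δ (sTy (aTy (pi A B)) σ)
  mkPi_s : ∀ {Ξ Δ Γ : Con} {A : Ty Γ} {B : Ty (ext Γ A)} (σ : Sub Δ (aCon Γ))
    (tk : (e : Fin 2) → Tm Δ (sTy (pi A B) (comp (k e Γ) σ)))
    (t : Tm Δ (sTy (pi (aTy A) (toForallCwF.aTyExt B)) σ))
    (h : toPreGlobalModel.Compatible σ tk t) (ρ : Sub Ξ Δ)
    (tk' : (e : Fin 2) → Tm Ξ (sTy (pi A B) (comp (k e Γ) (comp σ ρ))))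
    (t' : Tm Ξ (sTy (pi (aTy A) (toForallCwF.aTyExt B)) (comp σ ρ)))
    (h' : toPreGlobalModel.Compatible (comp σ ρ) tk' t'),
    (∀ e, HEq (tk' e) (sTm (tk e) ρ)) → HEq t' (sTm t ρ) →
    HEq (sTm (mkPi σ tk t h) ρ) (mkPi (comp σ ρ) tk' t' h')
  mkPi_k : ∀ {Δ Γ : Con} {A : Ty Γ} {B : Ty (ext Γ A)} (σ : Sub Δ (aCon Γ))
    (tk : (e : Fin 2) → Tm Δ (sTy (pi A B) (comp (k e Γ) σ)))
    (t : Tm Δ (sTy (pi (aTy A) (toForallCwF.aTyExt B)) σ))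
    (h : toPreGlobalModel.Compatible σ tk t) (e : Fin 2),
    HEq (toForallCwF.kTm e (pi A B) (toForallCwF.toExt (pair σ (mkPi σ tk t h)))) (tk e)
  mkPi_app : ∀ {Δ Γ : Con} {A : Ty Γ} {B : Ty (ext Γ A)} (σ : Sub Δ (aCon Γ))
    (tk : (e : Fin 2) → Tm Δ (sTy (pi A B) (comp (k e Γ) σ)))
    (t : Tm Δ (sTy (pi (aTy A) (toForallCwF.aTyExt B)) σ))
    (h : toPreGlobalModel.Compatible σ tk t),
    HEq (toPreGlobalModel.lamAllApp A B σ (mkPi σ tk t h)) t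
  mkPi_eta : ∀ {Δ Γ : Con} {A : Ty Γ} {B : Ty (ext Γ A)} (σ : Sub Δ (aCon Γ))
    (t₂ : Tm Δ (sTy (aTy (pi A B)) σ))
    (tk : (e : Fin 2) → Tm Δ (sTy (pi A B) (comp (k e Γ) σ)))
    (t : Tm Δ (sTy (pi (aTy A) (toForallCwF.aTyExt B)) σ))
    (h : toPreGlobalModel.Compatible σ tk t),
    (∀ e, HEq (tk e) (toForallCwF.kTm e (pi A B) (toForallCwF.toExt (pair σ t₂)))) →
    HEq t (toPreGlobalModel.lamAllApp A B σ t₂) → mkPi σ tk t h = t₂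
  unspan : {Γ : Con} → {i : L} → (Ak : Fin 2 → Ty Γ) → (A : Ty Γ) →
    (∀ e, lev (Ak e) = i) → lev A = i → ((e : Fin 2) → Tm (ext Γ A) (sTy (Ak e) (p A))) →
    Tm Γ (sTy (aTy (U emp i)) (toForallCwF.epsAll Γ))
  unspan_s : ∀ {Δ Γ : Con} {i : L} (Ak : Fin 2 → Ty Γ) (A : Ty Γ) (hk : ∀ e, lev (Ak e) = i)
    (h : lev A = i) (tk : (e : Fin 2) → Tm (ext Γ A) (sTy (Ak e) (p A))) (σ : Sub Δ Γ)
    (tk' : (e : Fin 2) → Tm (ext Δ (sTy A σ)) (sTy (sTy (Ak e) σ) (p (sTy A σ)))),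
    (∀ e, HEq (tk' e) (sTm (tk e) (toCwF.lift σ A))) →
    HEq (sTm (unspan Ak A hk h tk) σ)
      (unspan (fun e => sTy (Ak e) σ) (sTy A σ) (fun e => (lev_s _ _).trans (hk e))
        ((lev_s _ _).trans h) tk')
  unspan_base : ∀ {Γ : Con} {i : L} (Ak : Fin 2 → Ty Γ) (A : Ty Γ) (hk : ∀ e, lev (Ak e) = i)
    (h : lev A = i) (tk : (e : Fin 2) → Tm (ext Γ A) (sTy (Ak e) (p A))) (e : Fin 2),
    sTy (toPreGlobalModel.uElk e i) (toPreGlobalModel.uSub (unspan Ak A hk h tk)) = Ak e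
  unspan_apex : ∀ {Γ : Con} {i : L} (Ak : Fin 2 → Ty Γ) (A : Ty Γ) (hk : ∀ e, lev (Ak e) = i)
    (h : lev A = i) (tk : (e : Fin 2) → Tm (ext Γ A) (sTy (Ak e) (p A))),
    sTy (aTy (toPreGlobalModel.uEl i)) (toPreGlobalModel.uSub (unspan Ak A hk h tk)) = A
  unspan_leg : ∀ {Γ : Con} {i : L} (Ak : Fin 2 → Ty Γ) (A : Ty Γ) (hk : ∀ e, lev (Ak e) = i)
    (h : lev A = i) (tk : (e : Fin 2) → Tm (ext Γ A) (sTy (Ak e) (p A))) (e : Fin 2),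
    HEq (toForallCwF.kTm e (toPreGlobalModel.uEl i) (toForallCwF.toExt
      (toCwF.lift (toPreGlobalModel.uSub (unspan Ak A hk h tk)) (aTy (toPreGlobalModel.uEl i)))))
      (tk e)

/-- Formal morphisms of the cube category: `CubeRaw J I` consists of the expressions for morphisms
from `J` to `I` (natural numbers are dimensions). -/
inductive CubeRaw : ℕ → ℕ → Type
  | id (I : ℕ) : CubeRaw I I
  | comp {K J I : ℕ} (f : CubeRaw J I) (g : CubeRaw K J) : CubeRaw K I
  | suc {J I : ℕ} (f : CubeRaw J I) : CubeRaw (J + 1) (I + 1)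
  | face (e : Fin 2) (I : ℕ) : CubeRaw I (I + 1)
  | deg (I : ℕ) : CubeRaw (I + 1) I
  | sym (I : ℕ) : CubeRaw (I + 2) (I + 2)

/-- The least congruence on formal morphisms containing the equations of the BCH cube category. -/
inductive CubeRel : {J I : ℕ} → CubeRaw J I → CubeRaw J I → Prop
  | refl {J I : ℕ} (f : CubeRaw J I) : CubeRel f f
  | symm {J I : ℕ} {f g : CubeRaw J I} : CubeRel f g → CubeRel g f
  | trans {J I : ℕ} {f g h : CubeRaw J I} : CubeRel f g → CubeRel g h → CubeRel f h
  | comp_congr {K J I : ℕ} {f f' : CubeRaw J I} {g g' : CubeRaw K J} :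
      CubeRel f f' → CubeRel g g' → CubeRel (f.comp g) (f'.comp g')
  | suc_congr {J I : ℕ} {f f' : CubeRaw J I} : CubeRel f f' → CubeRel f.suc f'.suc
  | id_comp {J I : ℕ} (f : CubeRaw J I) : CubeRel ((CubeRaw.id I).comp f) f
  | comp_id {J I : ℕ} (f : CubeRaw J I) : CubeRel (f.comp (CubeRaw.id J)) f
  | assoc {M K J I : ℕ} (f : CubeRaw J I) (g : CubeRaw K J) (h : CubeRaw M K) :
      CubeRel ((f.comp g).comp h) (f.comp (g.comp h))
  | suc_comp {K J I : ℕ} (f : CubeRaw J I) (g : CubeRaw K J) :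
      CubeRel (f.comp g).suc (f.suc.comp g.suc)
  | suc_id (I : ℕ) : CubeRel (CubeRaw.id I).suc (CubeRaw.id (I + 1))
  | face_nat (e : Fin 2) {J I : ℕ} (f : CubeRaw J I) :
      CubeRel ((CubeRaw.face e I).comp f) (f.suc.comp (CubeRaw.face e J))
  | deg_nat {J I : ℕ} (f : CubeRaw J I) :
      CubeRel ((CubeRaw.deg I).comp f.suc) (f.comp (CubeRaw.deg J))
  | sym_nat {J I : ℕ} (f : CubeRaw J I) :
      CubeRel ((CubeRaw.sym I).comp f.suc.suc) (f.suc.suc.comp (CubeRaw.sym J))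
  | deg_face (e : Fin 2) (I : ℕ) :
      CubeRel ((CubeRaw.deg I).comp (CubeRaw.face e I)) (CubeRaw.id I)
  | sym_face (e : Fin 2) (I : ℕ) :
      CubeRel ((CubeRaw.sym I).comp (CubeRaw.face e (I + 1))) (CubeRaw.face e I).suc
  | deg_sym (I : ℕ) :
      CubeRel ((CubeRaw.deg (I + 1)).comp (CubeRaw.sym I)) (CubeRaw.deg I).suc
  | sym_sym (I : ℕ) : CubeRel ((CubeRaw.sym I).comp (CubeRaw.sym I)) (CubeRaw.id (I + 2))
  | sym_braid (I : ℕ) :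
      CubeRel ((CubeRaw.sym (I + 1)).comp ((CubeRaw.sym I).suc.comp (CubeRaw.sym (I + 1))))
        ((CubeRaw.sym I).suc.comp ((CubeRaw.sym (I + 1)).comp (CubeRaw.sym I).suc))

/-- Equality of morphisms of the cube category. -/
def cubeSetoid (J I : ℕ) : Setoid (CubeRaw J I) where
  r := CubeRel
  iseqv := ⟨CubeRel.refl, CubeRel.symm, CubeRel.trans⟩

/-- The set `□(J, I)` of morphisms from `J` to `I` in the cube category. -/
def CubeHom (J I : ℕ) : Type := Quotient (cubeSetoid J I)

namespace CubeHom

def id (I : ℕ) : CubeHom I I := Quotient.mk _ (CubeRaw.id I)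

def comp {K J I : ℕ} (f : CubeHom J I) (g : CubeHom K J) : CubeHom K I :=
  Quotient.map₂ CubeRaw.comp (fun _ _ hf _ _ hg => CubeRel.comp_congr hf hg) f g

def suc {J I : ℕ} (f : CubeHom J I) : CubeHom (J + 1) (I + 1) :=
  Quotient.map CubeRaw.suc (fun _ _ hf => CubeRel.suc_congr hf) f

def face (e : Fin 2) (I : ℕ) : CubeHom I (I + 1) := Quotient.mk _ (CubeRaw.face e I)

def deg (I : ℕ) : CubeHom (I + 1) I := Quotient.mk _ (CubeRaw.deg I)

def sym (I : ℕ) : CubeHom (I + 2) (I + 2) := Quotient.mk _ (CubeRaw.sym I)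

theorem id_comp {J I : ℕ} (f : CubeHom J I) : (id I).comp f = f := by
  induction f using Quotient.ind; exact Quotient.sound (CubeRel.id_comp _)

theorem comp_id {J I : ℕ} (f : CubeHom J I) : f.comp (id J) = f := by
  induction f using Quotient.ind; exact Quotient.sound (CubeRel.comp_id _)

theorem assoc {M K J I : ℕ} (f : CubeHom J I) (g : CubeHom K J) (h : CubeHom M K) :
    (f.comp g).comp h = f.comp (g.comp h) := by
  induction f using Quotient.ind; induction g using Quotient.ind; induction h using Quotient.ind
  exact Quotient.sound (CubeRel.assoc _ _ _)

theorem suc_comp {K J I : ℕ} (f : CubeHom J I) (g : CubeHom K J) :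
    (f.comp g).suc = f.suc.comp g.suc := by
  induction f using Quotient.ind; induction g using Quotient.ind
  exact Quotient.sound (CubeRel.suc_comp _ _)

theorem suc_id (I : ℕ) : (id I).suc = id (I + 1) := Quotient.sound (CubeRel.suc_id I)

theorem face_nat (e : Fin 2) {J I : ℕ} (f : CubeHom J I) :
    (face e I).comp f = f.suc.comp (face e J) := by
  induction f using Quotient.ind; exact Quotient.sound (CubeRel.face_nat _ _)

theorem deg_nat {J I : ℕ} (f : CubeHom J I) : (deg I).comp f.suc = f.comp (deg J) := by
  induction f using Quotient.ind; exact Quotient.sound (CubeRel.deg_nat _)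

theorem sym_nat {J I : ℕ} (f : CubeHom J I) :
    (sym I).comp f.suc.suc = f.suc.suc.comp (sym J) := by
  induction f using Quotient.ind; exact Quotient.sound (CubeRel.sym_nat _)

theorem deg_face (e : Fin 2) (I : ℕ) : (deg I).comp (face e I) = id I :=
  Quotient.sound (CubeRel.deg_face e I)

theorem sym_face (e : Fin 2) (I : ℕ) : (sym I).comp (face e (I + 1)) = (face e I).suc :=
  Quotient.sound (CubeRel.sym_face e I)

theorem deg_sym (I : ℕ) : (deg (I + 1)).comp (sym I) = (deg I).suc :=
  Quotient.sound (CubeRel.deg_sym I)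

theorem sym_sym (I : ℕ) : (sym I).comp (sym I) = id (I + 2) :=
  Quotient.sound (CubeRel.sym_sym I)

theorem sym_braid (I : ℕ) :
    (sym (I + 1)).comp ((sym I).suc.comp (sym (I + 1))) =
      (sym I).suc.comp ((sym (I + 1)).comp (sym I).suc) :=
  Quotient.sound (CubeRel.sym_braid I)

theorem sym_face_suc (e : Fin 2) (I : ℕ) : (sym I).comp (face e I).suc = face e (I + 1) := by
  rw [← sym_face, ← assoc, sym_sym, id_comp]

theorem deg_suc_sym (I : ℕ) : (deg I).suc.comp (sym I) = deg (I + 1) := by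
  rw [← deg_sym, assoc, sym_sym, comp_id]

end CubeHom

/-- The objects of the BCH cube category `□`. -/
structure Cube where
  dim : ℕ

/-- The BCH cube category `□`. -/
instance : Category Cube where
  Hom J I := CubeHom J.dim I.dim
  id I := CubeHom.id I.dim
  comp g f := CubeHom.comp f g
  id_comp f := CubeHom.comp_id f
  comp_id f := CubeHom.id_comp f
  assoc h g f := (CubeHom.assoc f g h).symm

/-- The endofunctor `suc` of the cube category. -/
def sucFunctor : Cube ⥤ Cube where
  obj I := ⟨I.dim + 1⟩
  map f := CubeHom.suc f
  map_id I := CubeHom.suc_id I.dim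
  map_comp g f := CubeHom.suc_comp f g

/-- Presheaves of `v`-small sets on the cube category. -/
abbrev Psh := Cubeᵒᵖ ⥤ Type v

/-- The restriction `x[f]` of `x : Γ I` along `f : □(J, I)`. -/
def Psh.res (Γ : Psh.{v}) {J I : ℕ} (x : Γ.obj (op ⟨I⟩)) (f : CubeHom J I) : Γ.obj (op ⟨J⟩) :=
  (Γ.map (Quiver.Hom.op (show (Cube.mk J) ⟶ (Cube.mk I) from f))) x

theorem Psh.res_id (Γ : Psh.{v}) {I : ℕ} (x : Γ.obj (op ⟨I⟩)) : Γ.res x (CubeHom.id I) = x := by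
  have h := Γ.map_id (op ⟨I⟩)
  exact congrArg (fun m => m x) h

theorem Psh.res_comp (Γ : Psh.{v}) {K J I : ℕ} (x : Γ.obj (op ⟨I⟩)) (f : CubeHom J I)
    (g : CubeHom K J) : Γ.res x (f.comp g) = Γ.res (Γ.res x f) g := by
  have h := Γ.map_comp (Quiver.Hom.op (show (Cube.mk J) ⟶ (Cube.mk I) from f))
    (Quiver.Hom.op (show (Cube.mk K) ⟶ (Cube.mk J) from g))
  exact congrArg (fun m => m x) h

theorem Psh.res_comp₃ (Γ : Psh.{v}) {I : ℕ} (x : Γ.obj (op ⟨I⟩)) (f g h : CubeHom I I) :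
    Γ.res (Γ.res (Γ.res x f) g) h = Γ.res x (f.comp (g.comp h)) := by
  rw [Psh.res_comp, Psh.res_comp]

/-- The value of a presheaf map at dimension `I`. -/
def Psh.ap {Δ Γ : Psh.{v}} (σ : Δ ⟶ Γ) {I : ℕ} (x : Δ.obj (op ⟨I⟩)) : Γ.obj (op ⟨I⟩) :=
  σ.app (op ⟨I⟩) x

theorem Psh.ap_res {Δ Γ : Psh.{v}} (σ : Δ ⟶ Γ) {J I : ℕ} (x : Δ.obj (op ⟨I⟩))
    (f : CubeHom J I) : Psh.ap σ (Δ.res x f) = Γ.res (Psh.ap σ x) f := by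
  have h := σ.naturality (Quiver.Hom.op (show (Cube.mk J) ⟶ (Cube.mk I) from f))
  exact congrArg (fun m => m x) h

/-- Constructor for presheaves on the cube category from unbundled data. -/
def Psh.mk (X : ℕ → Type v) (r : {J I : ℕ} → X I → CubeHom J I → X J)
    (r_id : ∀ {I : ℕ} (x : X I), r x (CubeHom.id I) = x)
    (r_comp : ∀ {K J I : ℕ} (x : X I) (f : CubeHom J I) (g : CubeHom K J),
      r x (f.comp g) = r (r x f) g) : Psh.{v} where
  obj I := X I.unop.dim
  map f := TypeCat.ofHom (fun x => r x f.unop)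
  map_id I := by ext x; exact r_id x
  map_comp f g := by ext x; exact r_comp x f.unop g.unop

/-- Constructor for presheaf maps from unbundled data. -/
def Psh.mkHom {Δ Γ : Psh.{v}} (s : {I : ℕ} → Δ.obj (op ⟨I⟩) → Γ.obj (op ⟨I⟩))
    (s_nat : ∀ {J I : ℕ} (x : Δ.obj (op ⟨I⟩)) (f : CubeHom J I),
      s (Δ.res x f) = Γ.res (s x) f) : Δ ⟶ Γ where
  app I := TypeCat.ofHom (fun x => s x)
  naturality I J f := by ext x; exact s_nat x f.unop

theorem Psh.hom_ext {Δ Γ : Psh.{v}} {σ τ : Δ ⟶ Γ}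
    (h : ∀ {I : ℕ} (x : Δ.obj (op ⟨I⟩)), Psh.ap σ x = Psh.ap τ x) : σ = τ := by
  ext I x; exact h x

/-- Dependent presheaves over `Γ`. For `f : □(J, I)`, the restriction map from `A I γ` to
`A J (γ[f])` is written with an arbitrary `γ'` equal to `γ[f]`. -/
@[ext]
structure DepPsh (Γ : Psh.{v}) where
  obj : {I : ℕ} → Γ.obj (op ⟨I⟩) → Type v
  res : {J I : ℕ} → (f : CubeHom J I) → {x : Γ.obj (op ⟨I⟩)} → {y : Γ.obj (op ⟨J⟩)} →
    Γ.res x f = y → obj x → obj y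
  res_id : ∀ {I : ℕ} {x : Γ.obj (op ⟨I⟩)} (h : Γ.res x (CubeHom.id I) = x) (a : obj x),
    res (CubeHom.id I) h a = a
  res_comp : ∀ {K J I : ℕ} (f : CubeHom J I) (g : CubeHom K J) {x : Γ.obj (op ⟨I⟩)}
    {y : Γ.obj (op ⟨J⟩)} {z : Γ.obj (op ⟨K⟩)} (hf : Γ.res x f = y) (hg : Γ.res y g = z)
    (h : Γ.res x (f.comp g) = z) (a : obj x), res (f.comp g) h a = res g hg (res f hf a)

/-- Sections (dependent natural transformations) of a dependent presheaf. -/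
@[ext]
structure DepPsh.Section {Γ : Psh.{v}} (A : DepPsh Γ) where
  app : {I : ℕ} → (x : Γ.obj (op ⟨I⟩)) → A.obj x
  nat : ∀ {J I : ℕ} (f : CubeHom J I) {x : Γ.obj (op ⟨I⟩)} {y : Γ.obj (op ⟨J⟩)}
    (h : Γ.res x f = y), A.res f h (app x) = app y

/-- Instantiation `A[σ]`. -/
def DepPsh.sub {Δ Γ : Psh.{v}} (A : DepPsh Γ) (σ : Δ ⟶ Γ) : DepPsh Δ where
  obj x := A.obj (Psh.ap σ x)
  res f _ _ h a := A.res f ((Psh.ap_res σ _ f).symm.trans (congrArg (Psh.ap σ) h)) a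
  res_id _ a := A.res_id _ a
  res_comp f g _ _ _ _ _ _ a := A.res_comp f g _ _ _ a

/-- Instantiation `t[σ]`. -/
def DepPsh.Section.sub {Δ Γ : Psh.{v}} {A : DepPsh Γ} (t : A.Section) (σ : Δ ⟶ Γ) :
    (A.sub σ).Section where
  app x := t.app (Psh.ap σ x)
  nat f _ _ h := t.nat f ((Psh.ap_res σ _ f).symm.trans (congrArg (Psh.ap σ) h))

theorem DepPsh.sigma_ext {Γ : Psh.{v}} (A : DepPsh Γ) {J I : ℕ} (f : CubeHom J I)
    {x : Γ.obj (op ⟨I⟩)} {y : Γ.obj (op ⟨J⟩)} (h : Γ.res x f = y) (a : A.obj x) :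
    (⟨Γ.res x f, A.res f rfl a⟩ : Σ z : Γ.obj (op ⟨J⟩), A.obj z) = ⟨y, A.res f h a⟩ := by
  subst h; rfl

/-- Context extension: the presheaf of pairs. -/
def DepPsh.total {Γ : Psh.{v}} (A : DepPsh Γ) : Psh.{v} :=
  Psh.mk (fun I => Σ x : Γ.obj (op ⟨I⟩), A.obj x) (fun x f => ⟨Γ.res x.1 f, A.res f rfl x.2⟩)
    (fun x => by
      rw [A.sigma_ext (CubeHom.id _) (Γ.res_id x.1), A.res_id])
    (fun x f g => by
      rw [A.sigma_ext (f.comp g) (Γ.res_comp x.1 f g), A.res_comp f g rfl rfl])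

/-- The empty context: the constant presheaf on a one-point set. -/
def Psh.unit : Psh.{v} := Psh.mk (fun _ => PUnit) (fun x _ => x) (fun _ => rfl) (fun _ _ _ => rfl)

/-- The CwF of presheaves on the cube category. -/
def pshCwF : CwF.{v + 1, v} where
  Con := Psh.{v}
  Sub Δ Γ := Δ ⟶ Γ
  Ty Γ := DepPsh Γ
  Tm _ A := A.Section
  id Γ := 𝟙 Γ
  comp σ ρ := ρ ≫ σ
  id_comp σ := Category.comp_id σ
  comp_id σ := Category.id_comp σ
  assoc σ ρ τ := (Category.assoc τ ρ σ).symm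
  emp := Psh.unit
  eps Γ := Psh.mkHom (fun _ => PUnit.unit) (fun _ _ => rfl)
  eps_eta σ := Psh.hom_ext (fun _ => rfl)
  sTy A σ := A.sub σ
  sTy_id A := rfl
  sTy_comp A σ ρ := rfl
  sTm t σ := t.sub σ
  sTm_id t := HEq.rfl
  sTm_comp t σ ρ := HEq.rfl
  ext Γ A := A.total
  p A := Psh.mkHom (fun x => x.1) (fun _ _ => rfl)
  q A := { app := fun x => x.2, nat := fun f _ _ h => by subst h; rfl }
  pair {_ _ A} σ t := Psh.mkHom (fun x => ⟨Psh.ap σ x, t.app x⟩) (fun x f => by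
    have h1 := A.sigma_ext f (Psh.ap_res σ x f).symm (t.app x)
    have h2 := t.nat f (rfl : Psh.res _ x f = _)
    exact (h1.trans (congrArg (Sigma.mk _) h2)).symm)
  p_pair σ t := rfl
  q_pair σ t := HEq.rfl
  pair_eta τ := rfl

/-- `∀` on presheaves is precomposition with `suc`. -/
def Psh.all (Γ : Psh.{v}) : Psh.{v} := sucFunctor.op ⋙ Γ

/-- `∀` on dependent presheaves is precomposition with `suc`. -/
def DepPsh.all {Γ : Psh.{v}} (A : DepPsh Γ) : DepPsh Γ.all where
  obj {I} x := A.obj (I := I + 1) x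
  res f _ _ h a := A.res f.suc h a
  res_id {I} x h a := by
    have key : ∀ (g : CubeHom (I + 1) (I + 1)) (hg : g = CubeHom.id (I + 1))
        (h : Psh.res Γ (I := I + 1) x g = x), A.res g h a = a := by
      rintro g rfl h; exact A.res_id h a
    exact key _ (CubeHom.suc_id I) h
  res_comp {K J I} f g x y z hf hg h a := by
    have key : ∀ (m : CubeHom (K + 1) (I + 1)) (hm : m = f.suc.comp g.suc)
        (h : Psh.res Γ (I := I + 1) x m = z), A.res m h a = A.res g.suc hg (A.res f.suc hf a) := by
      rintro m rfl h; exact A.res_comp f.suc g.suc hf hg h a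
    exact key _ (CubeHom.suc_comp f g) h

/-- The CwF of presheaves on the cube category with `∀`, `k`, `R` and `S`. -/
def PSh : ForallCwF.{v + 1, v} where
  toCwF := pshCwF.{v}
  aCon Γ := Psh.all Γ
  aSub σ := Functor.whiskerLeft sucFunctor.op σ
  aTy A := A.all
  aTm t := { app := fun {I} x => t.app (I := I + 1) x, nat := fun f _ _ h => t.nat f.suc h }
  aSub_id Γ := rfl
  aSub_comp σ ρ := rfl
  aTy_s A σ := rfl
  aTm_s t σ := HEq.rfl
  aCon_emp := rfl
  aCon_ext Γ A := rfl
  aSub_p A := HEq.rfl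
  aTm_q A := HEq.rfl
  k e Γ := Psh.mkHom (fun {I} x => Psh.res Γ (I := I + 1) x (CubeHom.face e I)) (fun {J I} x f =>
    (Psh.res_comp Γ (I := I + 1) x f.suc (CubeHom.face e J)).symm.trans
      ((congrArg (Psh.res Γ (I := I + 1) x) (CubeHom.face_nat e f).symm).trans
        (Psh.res_comp Γ (I := I + 1) x (CubeHom.face e I) f)))
  k_nat e _ _ σ := Psh.hom_ext (fun {I} x => (Psh.ap_res σ (I := I + 1) x (CubeHom.face e I)).symm)
  R Γ := Psh.mkHom (Γ := Psh.all Γ) (fun {I} x => Psh.res Γ x (CubeHom.deg I)) (fun {J I} x f =>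
    (Psh.res_comp Γ x f (CubeHom.deg J)).symm.trans
      ((congrArg (Psh.res Γ x) (CubeHom.deg_nat f).symm).trans
        (Psh.res_comp Γ x (CubeHom.deg I) f.suc)))
  R_nat σ := Psh.hom_ext (fun {I} x => (Psh.ap_res σ x (CubeHom.deg I)).symm)
  S Γ := Psh.mkHom (Δ := Psh.all (Psh.all Γ)) (Γ := Psh.all (Psh.all Γ))
    (fun {I} x => Psh.res Γ (I := I + 2) x (CubeHom.sym I)) (fun {J I} x f =>
    (Psh.res_comp Γ (I := I + 2) x f.suc.suc (CubeHom.sym J)).symm.trans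
      ((congrArg (Psh.res Γ (I := I + 2) x) (CubeHom.sym_nat f).symm).trans
        (Psh.res_comp Γ (I := I + 2) x (CubeHom.sym I) f.suc.suc)))
  S_nat σ := Psh.hom_ext (fun {I} x => (Psh.ap_res σ (I := I + 2) x (CubeHom.sym I)).symm)
  k_R e Γ := Psh.hom_ext (fun {I} x =>
    (Psh.res_comp Γ x (CubeHom.deg I) (CubeHom.face e I)).symm.trans
      ((congrArg (Psh.res Γ x) (CubeHom.deg_face e I)).trans (Psh.res_id Γ x)))
  k_S e Γ := Psh.hom_ext (fun {I} x =>
    (Psh.res_comp Γ (I := I + 2) x (CubeHom.sym I) (CubeHom.face e I).suc).symm.trans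
      (congrArg (Psh.res Γ (I := I + 2) x) (CubeHom.sym_face_suc e I)))
  S_R Γ := Psh.hom_ext (fun {I} x =>
    (Psh.res_comp Γ (I := I + 1) x (CubeHom.deg I).suc (CubeHom.sym I)).symm.trans
      (congrArg (Psh.res Γ (I := I + 1) x) (CubeHom.deg_suc_sym I)))
  S_S Γ := Psh.hom_ext (fun {I} x =>
    (Psh.res_comp Γ (I := I + 2) x (CubeHom.sym I) (CubeHom.sym I)).symm.trans
      ((congrArg (Psh.res Γ (I := I + 2) x) (CubeHom.sym_sym I)).trans
        (Psh.res_id Γ (I := I + 2) x)))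
  S_braid Γ := Psh.hom_ext (fun {I} x => by
    have h := Psh.res_comp₃ (I := I + 3) Γ
    exact (h x (CubeHom.sym I).suc (CubeHom.sym (I + 1)) (CubeHom.sym I).suc).trans
      ((congrArg (Psh.res Γ (I := I + 3) x) (CubeHom.sym_braid I).symm).trans
        (h x (CubeHom.sym (I + 1)) (CubeHom.sym I).suc (CubeHom.sym (I + 1))).symm))

/-- The four maps of a morphism between CwFs with `∀`. -/
structure MorphismData (C : ForallCwF.{u, v}) (D : ForallCwF.{u', v'}) where
  con : C.Con → D.Con
  sub : {Δ Γ : C.Con} → C.Sub Δ Γ → D.Sub (con Δ) (con Γ)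
  ty : {Γ : C.Con} → C.Ty Γ → D.Ty (con Γ)
  tm : {Γ : C.Con} → {A : C.Ty Γ} → C.Tm Γ A → D.Tm (con Γ) (ty A)

/-- Weak morphisms: functors that preserve instantiation of types and terms strictly, `◇` and `▷` up
to isomorphism, and `∀`, `k`, `R`, `S` strictly. These are all the operations that the notion of weak
morphism between models of the global theory refers to. -/
structure WeakMorphism (C : ForallCwF.{u, v}) (D : ForallCwF.{u', v'}) extends
    MorphismData C D where
  sub_comp : ∀ {Θ Δ Γ : C.Con} (σ : C.Sub Δ Γ) (ρ : C.Sub Θ Δ),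
    sub (C.comp σ ρ) = D.comp (sub σ) (sub ρ)
  sub_id : ∀ Γ : C.Con, sub (C.id Γ) = D.id (con Γ)
  ty_s : ∀ {Δ Γ : C.Con} (A : C.Ty Γ) (σ : C.Sub Δ Γ), ty (C.sTy A σ) = D.sTy (ty A) (sub σ)
  tm_s : ∀ {Δ Γ : C.Con} {A : C.Ty Γ} (t : C.Tm Γ A) (σ : C.Sub Δ Γ),
    HEq (tm (C.sTm t σ)) (D.sTm (tm t) (sub σ))
  /-- The inverse of the comparison map `ε` for the empty context. -/
  empInv : D.Sub D.emp (con C.emp)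
  empInv_eps : D.comp empInv (D.eps (con C.emp)) = D.id (con C.emp)
  /-- The inverse of the comparison map `(F p, F q)` for context extension. -/
  extInv : (Γ : C.Con) → (A : C.Ty Γ) → D.Sub (D.ext (con Γ) (ty A)) (con (C.ext Γ A))
  extInv_pair : ∀ (Γ : C.Con) (A : C.Ty Γ),
    D.comp (extInv Γ A) (D.pair (sub (C.p A)) (D.coe (ty_s A (C.p A)) (tm (C.q A)))) =
      D.id (con (C.ext Γ A))
  pair_extInv : ∀ (Γ : C.Con) (A : C.Ty Γ),
    D.comp (D.pair (sub (C.p A)) (D.coe (ty_s A (C.p A)) (tm (C.q A)))) (extInv Γ A) =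
      D.id (D.ext (con Γ) (ty A))
  con_all : ∀ Γ : C.Con, con (C.aCon Γ) = D.aCon (con Γ)
  sub_all : ∀ {Δ Γ : C.Con} (σ : C.Sub Δ Γ), HEq (sub (C.aSub σ)) (D.aSub (sub σ))
  ty_all : ∀ {Γ : C.Con} (A : C.Ty Γ), HEq (ty (C.aTy A)) (D.aTy (ty A))
  tm_all : ∀ {Γ : C.Con} {A : C.Ty Γ} (t : C.Tm Γ A), HEq (tm (C.aTm t)) (D.aTm (tm t))
  sub_k : ∀ (e : Fin 2) (Γ : C.Con), HEq (sub (C.k e Γ)) (D.k e (con Γ))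
  sub_R : ∀ Γ : C.Con, HEq (sub (C.R Γ)) (D.R (con Γ))
  sub_S : ∀ Γ : C.Con, HEq (sub (C.S Γ)) (D.S (con Γ))

namespace ForallCwF

variable (C : ForallCwF.{u, v})

/-- The iterated context `∀ⁿ Γ`. -/
def iCon : ℕ → C.Con → C.Con
  | 0, Γ => Γ
  | n + 1, Γ => iCon n (C.aCon Γ)

/-- The iterated substitution `∀ⁿ σ`. -/
def iSub : (n : ℕ) → {Δ Γ : C.Con} → C.Sub Δ Γ → C.Sub (C.iCon n Δ) (C.iCon n Γ)
  | 0, _, _, σ => σ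
  | n + 1, _, _, σ => iSub n (C.aSub σ)

/-- The iterated type `∀ⁿ A`. -/
def iTy : (n : ℕ) → {Γ : C.Con} → C.Ty Γ → C.Ty (C.iCon n Γ)
  | 0, _, A => A
  | n + 1, _, A => iTy n (C.aTy A)

/-- The iterated term `∀ⁿ t`. -/
def iTm : (n : ℕ) → {Γ : C.Con} → {A : C.Ty Γ} → C.Tm Γ A → C.Tm (C.iCon n Γ) (C.iTy n A)
  | 0, _, _, t => t
  | n + 1, _, _, t => iTm n (C.aTm t)

theorem iCon_ext (n : ℕ) : ∀ (Γ : C.Con) (A : C.Ty Γ),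
    C.iCon n (C.ext Γ A) = C.ext (C.iCon n Γ) (C.iTy n A) := by
  induction n with
  | zero => intro Γ A; rfl
  | succ n ih => intro Γ A; exact (congrArg (C.iCon n) (C.aCon_ext Γ A)).trans (ih _ _)

theorem iSub_id (n : ℕ) : ∀ Γ : C.Con, C.iSub n (C.id Γ) = C.id (C.iCon n Γ) := by
  induction n with
  | zero => intro Γ; rfl
  | succ n ih => intro Γ; exact (congrArg (C.iSub n) (C.aSub_id Γ)).trans (ih _)

theorem iSub_comp (n : ℕ) : ∀ {Θ Δ Γ : C.Con} (σ : C.Sub Δ Γ) (ρ : C.Sub Θ Δ),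
    C.iSub n (C.comp σ ρ) = C.comp (C.iSub n σ) (C.iSub n ρ) := by
  induction n with
  | zero => intros; rfl
  | succ n ih => intro _ _ _ σ ρ; exact (congrArg (C.iSub n) (C.aSub_comp σ ρ)).trans (ih _ _)

theorem iTy_s (n : ℕ) : ∀ {Δ Γ : C.Con} (A : C.Ty Γ) (σ : C.Sub Δ Γ),
    C.iTy n (C.sTy A σ) = C.sTy (C.iTy n A) (C.iSub n σ) := by
  induction n with
  | zero => intros; rfl
  | succ n ih => intro _ _ A σ; exact (congrArg (C.iTy n) (C.aTy_s A σ)).trans (ih _ _)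

theorem iTm_congr (n : ℕ) {Γ : C.Con} {A B : C.Ty Γ} (h : A = B) {t : C.Tm Γ A} {t' : C.Tm Γ B}
    (ht : HEq t t') : HEq (C.iTm n t) (C.iTm n t') := by
  subst h; rw [eq_of_heq ht]

theorem iTm_s (n : ℕ) : ∀ {Δ Γ : C.Con} {A : C.Ty Γ} (t : C.Tm Γ A) (σ : C.Sub Δ Γ),
    HEq (C.iTm n (C.sTm t σ)) (C.sTm (C.iTm n t) (C.iSub n σ)) := by
  induction n with
  | zero => intros; exact HEq.rfl
  | succ n ih =>
    intro _ _ A t σ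
    exact (C.iTm_congr n (C.aTy_s A σ) (C.aTm_s t σ)).trans (ih _ _)

theorem iSub_p (n : ℕ) : ∀ {Γ : C.Con} (A : C.Ty Γ),
    HEq (C.iSub n (C.p A)) (C.p (C.iTy n A)) := by
  induction n with
  | zero => intros; exact HEq.rfl
  | succ n ih =>
    intro Γ A
    have key : ∀ (X : C.Con) (hX : C.aCon (C.ext Γ A) = X) (s : C.Sub X (C.aCon Γ)),
        HEq (C.aSub (C.p A)) s → HEq (C.iSub n (C.aSub (C.p A))) (C.iSub n s) := by
      rintro X rfl s hs; rw [eq_of_heq hs]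
    exact (key _ (C.aCon_ext Γ A) _ (C.aSub_p A)).trans (ih _)

theorem iTm_q (n : ℕ) : ∀ {Γ : C.Con} (A : C.Ty Γ),
    HEq (C.iTm n (C.q A)) (C.q (C.iTy n A)) := by
  induction n with
  | zero => intros; exact HEq.rfl
  | succ n ih =>
    intro Γ A
    have key : ∀ (X : C.Con) (hX : C.aCon (C.ext Γ A) = X) (T : C.Ty X)
        (hT : HEq (C.aTy (C.sTy A (C.p A))) T) (s : C.Tm X T),
        HEq (C.aTm (C.q A)) s → HEq (C.iTm n (C.aTm (C.q A))) (C.iTm n s) := by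
      rintro X rfl T hT s hs; cases hT; rw [eq_of_heq hs]
    have hT : HEq (C.aTy (C.sTy A (C.p A))) (C.sTy (C.aTy A) (C.p (C.aTy A))) := by
      rw [C.aTy_s]
      have key' : ∀ (X : C.Con) (hX : C.aCon (C.ext Γ A) = X) (s : C.Sub X (C.aCon Γ)),
          HEq (C.aSub (C.p A)) s → HEq (C.sTy (C.aTy A) (C.aSub (C.p A))) (C.sTy (C.aTy A) s) := by
        rintro X rfl s hs; rw [eq_of_heq hs]
      exact key' _ (C.aCon_ext Γ A) _ (C.aSub_p A)
    exact (key _ (C.aCon_ext Γ A) _ hT _ (C.aTm_q A)).trans (ih _)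

/-- A substitution into `∀ⁿΓ ▷ ∀ⁿA`, seen as a substitution into `∀ⁿ(Γ ▷ A)`. -/
def iToExt (n : ℕ) {Δ Γ : C.Con} {A : C.Ty Γ} (τ : C.Sub Δ (C.ext (C.iCon n Γ) (C.iTy n A))) :
    C.Sub Δ (C.iCon n (C.ext Γ A)) :=
  cast (congrArg (C.Sub Δ) (C.iCon_ext n Γ A).symm) τ

/-- A substitution into `∀ⁿ(Γ ▷ A)`, seen as a substitution into `∀ⁿΓ ▷ ∀ⁿA`. -/
def iOfExt (n : ℕ) {Δ Γ : C.Con} {A : C.Ty Γ} (τ : C.Sub Δ (C.iCon n (C.ext Γ A))) :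
    C.Sub Δ (C.ext (C.iCon n Γ) (C.iTy n A)) :=
  cast (congrArg (C.Sub Δ) (C.iCon_ext n Γ A)) τ

theorem iToExt_iOfExt (n : ℕ) {Δ Γ : C.Con} {A : C.Ty Γ} (τ : C.Sub Δ (C.iCon n (C.ext Γ A))) :
    C.iToExt n (C.iOfExt n τ) = τ := by
  simp [iToExt, iOfExt]

theorem iOfExt_iToExt (n : ℕ) {Δ Γ : C.Con} {A : C.Ty Γ}
    (τ : C.Sub Δ (C.ext (C.iCon n Γ) (C.iTy n A))) : C.iOfExt n (C.iToExt n τ) = τ := by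
  simp [iToExt, iOfExt]

theorem p_iOfExt (n : ℕ) {Δ Γ : C.Con} {A : C.Ty Γ} (τ : C.Sub Δ (C.iCon n (C.ext Γ A))) :
    C.comp (C.p (C.iTy n A)) (C.iOfExt n τ) = C.comp (C.iSub n (C.p A)) τ := by
  have key : ∀ (X : C.Con) (hX : C.iCon n (C.ext Γ A) = X) (s : C.Sub X (C.iCon n Γ)),
      HEq (C.iSub n (C.p A)) s →
      C.comp s (cast (congrArg (C.Sub Δ) hX) τ) = C.comp (C.iSub n (C.p A)) τ := by
    rintro X rfl s hs; rw [eq_of_heq hs]; rfl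
  exact key _ (C.iCon_ext n Γ A) _ (C.iSub_p n A)

theorem q_iOfExt (n : ℕ) {Δ Γ : C.Con} {A : C.Ty Γ} (τ : C.Sub Δ (C.iCon n (C.ext Γ A))) :
    HEq (C.sTm (C.q (C.iTy n A)) (C.iOfExt n τ)) (C.sTm (C.iTm n (C.q A)) τ) := by
  have key : ∀ (X : C.Con) (hX : C.iCon n (C.ext Γ A) = X) (T : C.Ty X)
      (hT : HEq (C.iTy n (C.sTy A (C.p A))) T) (s : C.Tm X T), HEq (C.iTm n (C.q A)) s →
      HEq (C.sTm s (cast (congrArg (C.Sub Δ) hX) τ)) (C.sTm (C.iTm n (C.q A)) τ) := by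
    rintro X rfl T hT s hs; cases hT; cases hs; rfl
  refine key _ (C.iCon_ext n Γ A) _ ?_ _ (C.iTm_q n A)
  rw [C.iTy_s]
  have key' : ∀ (X : C.Con) (hX : C.iCon n (C.ext Γ A) = X) (s : C.Sub X (C.iCon n Γ)),
      HEq (C.iSub n (C.p A)) s →
      HEq (C.sTy (C.iTy n A) (C.iSub n (C.p A))) (C.sTy (C.iTy n A) s) := by
    rintro X rfl s hs; cases hs; rfl
  exact key' _ (C.iCon_ext n Γ A) _ (C.iSub_p n A)

end ForallCwF

/-- An interpretation of the morphisms `f : □(J, I)` of the cube category as substitutions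
`⌜f⌝_Γ` from `∀^I Γ` to `∀^J Γ`: the clauses `map_id`, ..., `map_sym` define `⌜f⌝` by recursion on
`f` (so that they determine it), and `nat` is naturality in `Γ`. -/
structure CubeInterpretation (C : ForallCwF.{u, v}) where
  map : {J I : ℕ} → CubeHom J I → (Γ : C.Con) → C.Sub (C.iCon I Γ) (C.iCon J Γ)
  map_id : ∀ (I : ℕ) (Γ : C.Con), map (CubeHom.id I) Γ = C.id (C.iCon I Γ)
  map_comp : ∀ {K J I : ℕ} (f : CubeHom J I) (g : CubeHom K J) (Γ : C.Con),
    map (f.comp g) Γ = C.comp (map g Γ) (map f Γ)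
  map_suc : ∀ {J I : ℕ} (f : CubeHom J I) (Γ : C.Con), map f.suc Γ = map f (C.aCon Γ)
  map_face : ∀ (e : Fin 2) (I : ℕ) (Γ : C.Con), map (CubeHom.face e I) Γ = C.iSub I (C.k e Γ)
  map_deg : ∀ (I : ℕ) (Γ : C.Con), map (CubeHom.deg I) Γ = C.iSub I (C.R Γ)
  map_sym : ∀ (I : ℕ) (Γ : C.Con), map (CubeHom.sym I) Γ = C.iSub I (C.S Γ)
  nat : ∀ {J I : ℕ} (f : CubeHom J I) {Δ Γ : C.Con} (σ : C.Sub Δ Γ),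
    C.comp (map f Γ) (C.iSub I σ) = C.comp (C.iSub J σ) (map f Δ)

namespace CubeInterpretation

variable {C : ForallCwF.{u, v}} (φ : CubeInterpretation C)

/-- The presheaf `I ↦ Sub ◇ (∀^I Γ)`, with restriction `γ[f] = ⌜f⌝_Γ ∘ γ`. -/
def nerveCon (Γ : C.Con) : Psh.{v} :=
  Psh.mk (fun I => C.Sub C.emp (C.iCon I Γ)) (fun x f => C.comp (φ.map f Γ) x)
    (fun x => by rw [φ.map_id, C.id_comp])
    (fun x f g => by rw [φ.map_comp, C.assoc])

theorem comp_nat {J I : ℕ} (f : CubeHom J I) {Δ Γ : C.Con} (σ : C.Sub Δ Γ)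
    (x : C.Sub C.emp (C.iCon I Δ)) : C.comp (C.iSub J σ) (C.comp (φ.map f Δ) x) =
      C.comp (φ.map f Γ) (C.comp (C.iSub I σ) x) := by
  rw [← C.assoc, ← φ.nat, C.assoc]

/-- The map of presheaves `δ ↦ ∀^I σ ∘ δ`. -/
def nerveSub {Δ Γ : C.Con} (σ : C.Sub Δ Γ) : φ.nerveCon Δ ⟶ φ.nerveCon Γ :=
  Psh.mkHom (fun {I} x => C.comp (C.iSub I σ) x) (fun {_ _} x f => φ.comp_nat f σ x)

/-- The substitution `⌜f⌝_{Γ ▷ A} ∘ (γ, a)` into `∀^J Γ ▷ ∀^J A`. -/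
def restrict {J I : ℕ} (f : CubeHom J I) {Γ : C.Con} (A : C.Ty Γ) {x : C.Sub C.emp (C.iCon I Γ)}
    (a : C.Tm C.emp (C.sTy (C.iTy I A) x)) : C.Sub C.emp (C.ext (C.iCon J Γ) (C.iTy J A)) :=
  C.iOfExt J (C.comp (φ.map f (C.ext Γ A)) (C.iToExt I (C.pair x a)))

theorem p_restrict {J I : ℕ} (f : CubeHom J I) {Γ : C.Con} (A : C.Ty Γ)
    {x : C.Sub C.emp (C.iCon I Γ)} (a : C.Tm C.emp (C.sTy (C.iTy I A) x)) :
    C.comp (C.p (C.iTy J A)) (φ.restrict f A a) = C.comp (φ.map f Γ) x := by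
  rw [restrict, C.p_iOfExt, ← C.assoc, ← φ.nat, C.assoc, ← C.p_iOfExt, C.iOfExt_iToExt, C.p_pair]

/-- The restriction `a[f] = q[⌜f⌝_{Γ ▷ A} ∘ (γ, a)]`. -/
def nerveRes {J I : ℕ} (f : CubeHom J I) {Γ : C.Con} (A : C.Ty Γ)
    {x : C.Sub C.emp (C.iCon I Γ)} {y : C.Sub C.emp (C.iCon J Γ)} (h : C.comp (φ.map f Γ) x = y)
    (a : C.Tm C.emp (C.sTy (C.iTy I A) x)) : C.Tm C.emp (C.sTy (C.iTy J A) y) :=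
  C.coe ((C.sTy_comp _ _ _).symm.trans (congrArg (C.sTy (C.iTy J A)) ((φ.p_restrict f A a).trans h)))
    (C.sTm (C.q (C.iTy J A)) (φ.restrict f A a))

theorem pair_nerveRes {J I : ℕ} (f : CubeHom J I) {Γ : C.Con} (A : C.Ty Γ)
    {x : C.Sub C.emp (C.iCon I Γ)} {y : C.Sub C.emp (C.iCon J Γ)} (h : C.comp (φ.map f Γ) x = y)
    (a : C.Tm C.emp (C.sTy (C.iTy I A) x)) :
    C.pair y (φ.nerveRes f A h a) = φ.restrict f A a := by
  apply C.sub_ext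
  · rw [C.p_pair, p_restrict, h]
  · exact (C.q_pair _ _).trans (C.coe_heq _ _)

theorem nerveRes_of_eq {J I : ℕ} (f : CubeHom J I) {Γ : C.Con} (A : C.Ty Γ)
    {x : C.Sub C.emp (C.iCon I Γ)} {y : C.Sub C.emp (C.iCon J Γ)} (h : C.comp (φ.map f Γ) x = y)
    (a : C.Tm C.emp (C.sTy (C.iTy I A) x)) (b : C.Tm C.emp (C.sTy (C.iTy J A) y))
    (hb : φ.restrict f A a = C.pair y b) : φ.nerveRes f A h a = b := by
  have h2 := (φ.pair_nerveRes f A h a).trans hb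
  refine eq_of_heq ((C.q_pair y _).symm.trans (HEq.trans ?_ (C.q_pair y b)))
  rw [h2]

theorem restrict_id {I : ℕ} {Γ : C.Con} (A : C.Ty Γ) {x : C.Sub C.emp (C.iCon I Γ)}
    (a : C.Tm C.emp (C.sTy (C.iTy I A) x)) :
    φ.restrict (CubeHom.id I) A a = C.pair x a := by
  rw [restrict, φ.map_id, C.id_comp, C.iOfExt_iToExt]

theorem restrict_comp {K J I : ℕ} (f : CubeHom J I) (g : CubeHom K J) {Γ : C.Con} (A : C.Ty Γ)
    {x : C.Sub C.emp (C.iCon I Γ)} {y : C.Sub C.emp (C.iCon J Γ)} (h : C.comp (φ.map f Γ) x = y)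
    (a : C.Tm C.emp (C.sTy (C.iTy I A) x)) :
    φ.restrict (f.comp g) A a = φ.restrict g A (φ.nerveRes f A h a) := by
  rw [restrict, restrict, φ.pair_nerveRes, restrict, C.iToExt_iOfExt, φ.map_comp, C.assoc]

/-- The dependent presheaf `(I, γ) ↦ Tm ◇ ((∀^I A)[γ])`. -/
def nerveTy {Γ : C.Con} (A : C.Ty Γ) : DepPsh (φ.nerveCon Γ) where
  obj {I} (x : C.Sub C.emp (C.iCon I Γ)) := C.Tm C.emp (C.sTy (C.iTy I A) x)
  res f _ _ h a := φ.nerveRes f A h a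
  res_id h a := φ.nerveRes_of_eq _ A h a a (φ.restrict_id A a)
  res_comp f g _ _ _ hf hg h a := φ.nerveRes_of_eq _ A h a _
    ((φ.restrict_comp f g A hf a).trans (φ.pair_nerveRes g A hg _).symm)

theorem pair_iTm (n : ℕ) {Γ : C.Con} {A : C.Ty Γ} (t : C.Tm Γ A)
    (x : C.Sub C.emp (C.iCon n Γ)) :
    C.pair x (C.sTm (C.iTm n t) x) = C.iOfExt n (C.comp (C.iSub n (C.sg t)) x) := by
  have e1 : C.comp (C.iSub n (C.p A)) (C.iSub n (C.sg t)) = C.id (C.iCon n Γ) := by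
    rw [← C.iSub_comp, CwF.sg, C.p_pair, C.iSub_id]
  apply C.sub_ext
  · rw [C.p_pair, C.p_iOfExt, ← C.assoc, e1, C.id_comp]
  · refine (C.q_pair _ _).trans ((C.q_iOfExt n _).trans ((C.sTm_comp _ _ _).trans ?_)).symm
    have key : ∀ (T T' : C.Ty (C.iCon n Γ)) (hT : T = T') (s : C.Tm _ T) (s' : C.Tm _ T'),
        HEq s s' → HEq (C.sTm s x) (C.sTm s' x) := by
      rintro T T' rfl s s' hs; rw [eq_of_heq hs]
    refine key _ _ ?_ _ _ ((C.iTm_s n _ _).symm.trans (C.iTm_congr n ?_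
      ((C.q_pair _ _).trans (C.coe_heq _ _))))
    · rw [C.iTy_s, ← C.sTy_comp, e1, C.sTy_id]
    · rw [← C.sTy_comp, CwF.sg, C.p_pair, C.sTy_id]

theorem restrict_iTm {J I : ℕ} (f : CubeHom J I) {Γ : C.Con} {A : C.Ty Γ} (t : C.Tm Γ A)
    (x : C.Sub C.emp (C.iCon I Γ)) :
    φ.restrict f A (C.sTm (C.iTm I t) x) =
      C.pair (C.comp (φ.map f Γ) x) (C.sTm (C.iTm J t) (C.comp (φ.map f Γ) x)) := by
  rw [restrict, pair_iTm, pair_iTm, C.iToExt_iOfExt, ← C.assoc, φ.nat, C.assoc]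

/-- The section `γ ↦ (∀^I t)[γ]`. -/
def nerveTm {Γ : C.Con} {A : C.Ty Γ} (t : C.Tm Γ A) : (φ.nerveTy A).Section where
  app {I} (x : C.Sub C.emp (C.iCon I Γ)) := C.sTm (C.iTm I t) x
  nat f x y h := by
    subst h
    exact φ.nerveRes_of_eq f A rfl _ _ (φ.restrict_iTm f t x)

/-- The maps of the global section functor determined by an interpretation of the cube morphisms. -/
def nerve : MorphismData C PSh.{v} where
  con Γ := φ.nerveCon Γ
  sub σ := φ.nerveSub σ
  ty A := φ.nerveTy A
  tm t := φ.nerveTm t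

end CubeInterpretation
end IntParam

/-! The functor is a nerve: an `I`-cube of `Γ` is a global element of `∀^I Γ`, and the cube category
acts on cubes because `∀` with `k`, `R`, `S` satisfies its presentation contravariantly. The
interpretation is first given on formal expressions. There each naturality equation of the
presentation is an instance of the naturality of `⌜f⌝` itself, taken at `k`, `R` or `S`
(`CubeRaw.interp_nat`). The equations between generators are images under `∀^I` of equations between
`k`, `R`, `S`. Since composition is reversed, those relating `S` to `k` and `R` are used in the form
obtained by cancelling the involution `S` (`CubeRel.interp_eq`).

For the weak morphism, an element `a` over `γ` is handled as the pair `(γ, a)`, so that every claim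
about types becomes an equation between substitutions into `∀^I(Γ ▷ A)`, tested on the `p` and `q`
components. Instantiation is preserved because `⌜f⌝` is natural at the lifting `σ↑` (`iOfExt_lift`,
`nerveRes_sTy`). Strict preservation of `∀` is an index shift: `∀^(I+1) Γ` is `∀^I(∀Γ)` by
definition, and `⌜suc f⌝_Γ = ⌜f⌝_{∀Γ}`. For types this also uses `∀(Γ ▷ A) = ∀Γ ▷ ∀A`
(`restrict_suc`). Preservation of `k`, `R`, `S` is what the clauses for the generators say. Finally,
the comparison map for `▷` is invertible by the universal property of pairing, and the one for `◇`
because every `∀^I ◇` is terminal. -/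

namespace IntParam

/-! ### Formal cube morphisms as natural substitutions. -/

namespace CubeRaw

variable (C : ForallCwF.{u, v})

/-- The interpretation of a formal morphism `f` from `J` to `I` as a substitution from `∀^I Γ` to
`∀^J Γ`. -/
def interp : {J I : ℕ} → CubeRaw J I → (Γ : C.Con) → C.Sub (C.iCon I Γ) (C.iCon J Γ)
  | _, _, .id I, Γ => C.id (C.iCon I Γ)
  | _, _, .comp f g, Γ => C.comp (interp g Γ) (interp f Γ)
  | _, _, .suc f, Γ => interp f (C.aCon Γ)
  | _, _, .face e I, Γ => C.iSub I (C.k e Γ)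
  | _, _, .deg I, Γ => C.iSub I (C.R Γ)
  | _, _, .sym I, Γ => C.iSub I (C.S Γ)

/-- Generators are `∀^I` applied to natural transformations, and naturality is stable under
composition. The statement precedes any quotienting because it also yields the naturality relations
of the cube category. -/
theorem interp_nat {J I : ℕ} (f : CubeRaw J I) : ∀ {Δ Γ : C.Con} (σ : C.Sub Δ Γ),
    C.comp (interp C f Γ) (C.iSub I σ) = C.comp (C.iSub J σ) (interp C f Δ) := by
  induction f with
  | id I => intro Δ Γ σ; exact (C.id_comp _).trans (C.comp_id _).symm
  | comp f g ihf ihg =>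
    intro Δ Γ σ
    change C.comp (C.comp _ _) _ = C.comp _ (C.comp _ _)
    rw [C.assoc, ihf, ← C.assoc, ihg, C.assoc]
  -- `∀^(I+1) σ` unfolds to `∀^I(∀σ)`, so the induction hypothesis is needed at another
  -- substitution; hence the quantification over `σ`.
  | suc f ih => intro Δ Γ σ; exact ih (C.aSub σ)
  | face e I =>
    intro Δ Γ σ
    exact (C.iSub_comp I _ _).symm.trans ((congrArg (C.iSub I) (C.k_nat e σ)).trans
      (C.iSub_comp I _ _))
  | deg I =>
    intro Δ Γ σ
    exact (C.iSub_comp I _ _).symm.trans ((congrArg (C.iSub I) (C.R_nat σ)).trans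
      (C.iSub_comp I _ _))
  | sym I =>
    intro Δ Γ σ
    exact (C.iSub_comp I _ _).symm.trans ((congrArg (C.iSub I) (C.S_nat σ)).trans
      (C.iSub_comp I _ _))

end CubeRaw

/-! ### Mirrored equations for `S`, and iterates of `∀` on `◇` and `▷`. -/

namespace ForallCwF

variable (C : ForallCwF.{u, v})

/-- Cancelling the involution `S` exchanges the two transformations `k_{∀Γ}` and `∀k_Γ`. The
reversal of composition in the interpretation calls for this form, and for the analogous one with
`R`. -/
theorem aSub_k_S (e : Fin 2) (Γ : C.Con) :
    C.comp (C.aSub (C.k e Γ)) (C.S Γ) = C.k e (C.aCon Γ) := by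
  rw [← C.k_S, C.assoc, C.S_S, C.comp_id]

theorem S_aSub_R (Γ : C.Con) : C.comp (C.S Γ) (C.aSub (C.R Γ)) = C.R (C.aCon Γ) := by
  rw [← C.S_R, ← C.assoc, C.S_S, C.id_comp]

theorem sTm_heq {Δ Γ : C.Con} {A A' : C.Ty Γ} (hA : A = A')
    {t : C.Tm Γ A} {t' : C.Tm Γ A'} (ht : HEq t t') (σ : C.Sub Δ Γ) :
    HEq (C.sTm t σ) (C.sTm t' σ) := by
  subst hA; rw [eq_of_heq ht]

/-- Since `p ∘ σ↑ = σ ∘ p` and `q[σ↑] = q`, the lifting acts by `σ` on the first component and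
leaves the second alone. Both `a` and `b` occur because their types are only provably equal. -/
theorem iOfExt_lift (n : ℕ) {Θ Δ Γ : C.Con} (σ : C.Sub Δ Γ) (A : C.Ty Γ)
    (x : C.Sub Θ (C.iCon n Δ)) (a : C.Tm Θ (C.sTy (C.iTy n (C.sTy A σ)) x))
    (b : C.Tm Θ (C.sTy (C.iTy n A) (C.comp (C.iSub n σ) x))) (h : HEq a b) :
    C.iOfExt n (C.comp (C.iSub n (C.lift σ A)) (C.iToExt n (C.pair x a))) =
      C.pair (C.comp (C.iSub n σ) x) b := by
  have e : C.comp (C.iSub n (C.p A)) (C.iSub n (C.lift σ A)) =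
      C.comp (C.iSub n σ) (C.iSub n (C.p (C.sTy A σ))) := by
    rw [← C.iSub_comp, ← C.iSub_comp, CwF.lift, C.p_pair]
  apply C.sub_ext
  · rw [C.p_iOfExt, C.p_pair, ← C.assoc, e, C.assoc, ← C.p_iOfExt, C.iOfExt_iToExt, C.p_pair]
  · refine (C.q_iOfExt n _).trans ((C.sTm_comp _ _ _).trans (HEq.trans ?_ (C.q_pair _ _).symm))
    -- The intermediate type is `∀^n` of `A[σ][p]`, the type of the variable to which `q[σ↑]`
    -- reduces.
    refine HEq.trans (C.sTm_heq (A' := C.iTy n (C.sTy (C.sTy A σ) (C.p (C.sTy A σ)))) ?_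
      ((C.iTm_s n _ _).symm.trans (C.iTm_congr n ?_ ((C.q_pair _ _).trans (C.coe_heq _ _)))) _) ?_
    · rw [C.iTy_s, C.iTy_s, C.iTy_s]
      exact (C.sTy_comp _ _ _).symm.trans ((congrArg (C.sTy (C.iTy n A)) e).trans
        (C.sTy_comp _ _ _))
    · rw [← C.sTy_comp, C.p_pair, C.sTy_comp]
    · refine (C.q_iOfExt n _).symm.trans (HEq.trans ?_ h)
      rw [C.iOfExt_iToExt]
      exact C.q_pair _ _

theorem iTy_sTy_sTy (n : ℕ) {Θ Δ Γ : C.Con} (A : C.Ty Γ) (σ : C.Sub Δ Γ)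
    (x : C.Sub Θ (C.iCon n Δ)) :
    C.sTy (C.iTy n (C.sTy A σ)) x = C.sTy (C.iTy n A) (C.comp (C.iSub n σ) x) := by
  rw [C.iTy_s, C.sTy_comp]

theorem iCon_emp (n : ℕ) :
    C.iCon n C.emp = C.emp := by
  induction n with
  | zero => rfl
  | succ n ih => exact (congrArg (C.iCon n) C.aCon_emp).trans ih

/-- `∀^n ◇` is provably, not definitionally, `◇`, so the uniqueness of `ε` has to be transported. -/
theorem sub_iCon_emp_eq (n : ℕ) {Γ : C.Con}
    (σ τ : C.Sub Γ (C.iCon n C.emp)) : σ = τ := by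
  have key : ∀ (X : C.Con), X = C.emp → ∀ σ τ : C.Sub Γ X, σ = τ := by
    rintro X rfl σ τ; rw [C.eps_eta σ, C.eps_eta τ]
  exact key _ (C.iCon_emp n) σ τ

/-- Pairing is injective, its components being recovered by `p` and `q`. -/
theorem sigma_tm_ext (n : ℕ) {Γ : C.Con} (A : C.Ty Γ)
    {z w : Σ x : C.Sub C.emp (C.iCon n Γ), C.Tm C.emp (C.sTy (C.iTy n A) x)}
    (h : C.pair z.1 z.2 = C.pair w.1 w.2) : z = w := by
  obtain ⟨x, a⟩ := z
  obtain ⟨y, b⟩ := w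
  have hx : x = y := by
    rw [← C.p_pair x a, ← C.p_pair y b]; exact congrArg _ h
  subst hx
  have hb : HEq a b :=
    (C.q_pair x a).symm.trans (HEq.trans (by dsimp only at h; rw [h]) (C.q_pair x b))
  rw [eq_of_heq hb]

/-- This is `η` for context extension, carried along `∀^n(Γ ▷ A) = ∀^n Γ ▷ ∀^n A`. Leaving `a`
arbitrary absorbs the coercion in the comparison map. -/
theorem pair_comparison (n : ℕ) {Γ : C.Con} (A : C.Ty Γ)
    (τ : C.Sub C.emp (C.iCon n (C.ext Γ A)))
    (a : C.Tm C.emp (C.sTy (C.iTy n A) (C.comp (C.iSub n (C.p A)) τ)))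
    (ha : HEq a (C.sTm (C.iTm n (C.q A)) τ)) :
    C.iToExt n (C.pair (C.comp (C.iSub n (C.p A)) τ) a) = τ := by
  refine Eq.trans (congrArg (C.iToExt n) ?_) (C.iToExt_iOfExt n τ)
  apply C.sub_ext
  · rw [C.p_pair, C.p_iOfExt]
  · exact (C.q_pair _ _).trans (ha.trans (C.q_iOfExt n τ).symm)

end ForallCwF

/-! ### Well-definedness on the cube category. -/

theorem CubeRel.interp_eq (C : ForallCwF.{u, v}) {J I : ℕ} {f g : CubeRaw J I}
    (h : CubeRel f g) : ∀ Γ : C.Con, f.interp C Γ = g.interp C Γ := by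
  induction h with
  | refl f => intro Γ; rfl
  | symm _ ih => intro Γ; exact (ih Γ).symm
  | trans _ _ ih ih' => intro Γ; exact (ih Γ).trans (ih' Γ)
  | comp_congr _ _ ih ih' => intro Γ; exact congrArg₂ C.comp (ih' Γ) (ih Γ)
  | suc_congr _ ih => intro Γ; exact ih _
  | id_comp f => intro Γ; exact C.comp_id _
  | comp_id f => intro Γ; exact C.id_comp _
  | assoc f g h => intro Γ; exact (C.assoc _ _ _).symm
  | suc_comp f g => intro Γ; rfl
  | suc_id I => intro Γ; rfl
  -- After reversal this square is the naturality of `⌜f⌝` at `k : ∀Γ ⟶ Γ`; likewise below with `R`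
  -- and `S`.
  | face_nat e f => intro Γ; exact f.interp_nat C (C.k e Γ)
  | deg_nat f => intro Γ; exact f.interp_nat C (C.R Γ)
  | sym_nat f => intro Γ; exact f.interp_nat C (C.S Γ)
  | deg_face e I =>
    intro Γ
    exact (C.iSub_comp I _ _).symm.trans ((congrArg (C.iSub I) (C.k_R e Γ)).trans (C.iSub_id I Γ))
  | sym_face e I =>
    intro Γ
    exact (C.iSub_comp I _ _).symm.trans (congrArg (C.iSub I) (C.aSub_k_S e Γ))
  | deg_sym I =>
    intro Γ
    exact (C.iSub_comp I _ _).symm.trans (congrArg (C.iSub I) (C.S_aSub_R Γ))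
  | sym_sym I =>
    intro Γ
    exact (C.iSub_comp I _ _).symm.trans ((congrArg (C.iSub I) (C.S_S Γ)).trans (C.iSub_id I _))
  | sym_braid I =>
    intro Γ
    have h : ∀ {Δ : C.Con} (σ τ ρ : C.Sub Δ Δ),
        C.comp (C.comp (C.iSub I σ) (C.iSub I τ)) (C.iSub I ρ) =
          C.iSub I (C.comp σ (C.comp τ ρ)) := by
      intro Δ σ τ ρ
      rw [C.assoc, ← C.iSub_comp, ← C.iSub_comp]
    -- Both braid words are palindromes, so reversal fixes them. But `sym (I+1)` becomes `∀S` and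
    -- `suc (sym I)` becomes `S` at `∀Γ`, which exchanges the two sides of `S_braid`.
    exact (h _ _ _).trans ((congrArg (C.iSub I) (C.S_braid Γ).symm).trans (h _ _ _).symm)

/-- The interpretation of the morphisms of the cube category. -/
def cubeInterpretation (C : ForallCwF.{u, v}) : CubeInterpretation C where
  map f Γ := Quotient.lift (fun f : CubeRaw _ _ => f.interp C Γ)
    (fun _ _ h => CubeRel.interp_eq C h Γ) f
  map_id _ _ := rfl
  map_comp f g Γ := by
    induction f using Quotient.ind; induction g using Quotient.ind; rfl
  map_suc f Γ := by induction f using Quotient.ind; rfl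
  map_face _ _ _ := rfl
  map_deg _ _ := rfl
  map_sym _ _ := rfl
  nat f _ _ σ := by induction f using Quotient.ind; exact CubeRaw.interp_nat C _ σ

/-! ### Extensionality across provably equal presheaves. -/

theorem Psh.mk_congr {X : ℕ → Type v} {r r' : {J I : ℕ} → X I → CubeHom J I → X J}
    (h : ∀ {J I : ℕ} (x : X I) (f : CubeHom J I), r x f = r' x f) i c i' c' :
    Psh.mk X r i c = Psh.mk X r' i' c' := by
  have : @r = @r' := by funext J I x f; exact h x f
  subst this; rfl

theorem Psh.hom_heq {Δ Δ' Γ Γ' : Psh.{v}} (hΔ : Δ = Δ') (hΓ : Γ = Γ') {σ : Δ ⟶ Γ} {τ : Δ' ⟶ Γ'}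
    (h : ∀ {I : ℕ} (x : Δ.obj (op ⟨I⟩)) (y : Δ'.obj (op ⟨I⟩)), HEq x y →
      HEq (Psh.ap σ x) (Psh.ap τ y)) : HEq σ τ := by
  subst hΔ hΓ
  exact heq_of_eq (Psh.hom_ext (fun x => eq_of_heq (h x x HEq.rfl)))

/-- Once the bases are identified, fibres and restrictions determine a dependent presheaf, its laws
being propositions. The heterogeneous form is needed because `∀` is preserved on contexts only up to
a provable equality. -/
theorem DepPsh.heq {Γ Γ' : Psh.{v}} (hΓ : Γ = Γ') {A : DepPsh Γ} {A' : DepPsh Γ'}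
    (hobj : ∀ {I : ℕ} (x : Γ.obj (op ⟨I⟩)) (x' : Γ'.obj (op ⟨I⟩)), HEq x x' → A.obj x = A'.obj x')
    (hres : ∀ {J I : ℕ} (f : CubeHom J I) {x : Γ.obj (op ⟨I⟩)} {y : Γ.obj (op ⟨J⟩)}
      {x' : Γ'.obj (op ⟨I⟩)} {y' : Γ'.obj (op ⟨J⟩)} (h : Γ.res x f = y) (h' : Γ'.res x' f = y')
      (a : A.obj x) (a' : A'.obj x'), HEq x x' → HEq y y' → HEq a a' →
      HEq (A.res f h a) (A'.res f h' a')) : HEq A A' := by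
  subst hΓ
  obtain ⟨obj, res, _, _⟩ := A
  obtain ⟨obj', res', _, _⟩ := A'
  have : @obj = @obj' := by funext I x; exact hobj x x HEq.rfl
  subst this
  have : @res = @res' := by
    funext J I f x y h a
    exact eq_of_heq (hres f h h a a HEq.rfl HEq.rfl HEq.rfl)
  subst this
  rfl

theorem DepPsh.section_heq {Γ Γ' : Psh.{v}} (hΓ : Γ = Γ') {A : DepPsh Γ} {A' : DepPsh Γ'}
    (hA : HEq A A') {t : A.Section} {t' : A'.Section}
    (h : ∀ {I : ℕ} (x : Γ.obj (op ⟨I⟩)) (x' : Γ'.obj (op ⟨I⟩)), HEq x x' →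
      HEq (t.app x) (t'.app x')) : HEq t t' := by
  subst hΓ; cases hA
  apply heq_of_eq
  apply DepPsh.Section.ext
  funext I x
  exact eq_of_heq (h x x HEq.rfl)

theorem DepPsh.section_coe_app {Γ : Psh.{v}} {A B : DepPsh Γ} (h : A = B) (t : A.Section) {I : ℕ}
    (x : Γ.obj (op ⟨I⟩)) : HEq ((PSh.{v}.coe h t : B.Section).app x) (t.app x) := by
  subst h; rfl

/-! ### The nerve preserves `∀`, instantiation, `k`, `R` and `S`. -/

namespace CubeInterpretation

variable {C : ForallCwF.{u, v}} (φ : CubeInterpretation C)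

/-- The sets of `I`-cubes coincide by definition; only the restrictions need the clause for `suc`.
-/
theorem nerveCon_aCon (Γ : C.Con) : φ.nerveCon (C.aCon Γ) = Psh.all (φ.nerveCon Γ) :=
  Psh.mk_congr (X := fun I => C.Sub C.emp (C.iCon (I + 1) Γ))
    (r := fun x f => C.comp (φ.map f (C.aCon Γ)) x)
    (r' := fun x f => C.comp (φ.map f.suc Γ) x)
    (fun x f => by rw [φ.map_suc]; rfl) _ _
    (fun {I} x => Psh.res_id (Psh.all (φ.nerveCon Γ)) (I := I) x)
    (fun {_ _ I} x f g => Psh.res_comp (Psh.all (φ.nerveCon Γ)) (I := I) x f g)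

/-- One side computes in `∀(Γ ▷ A)`, the other in `∀Γ ▷ ∀A`, and these contexts are equal. -/
theorem restrict_suc {J I : ℕ} (f : CubeHom J I) {Γ : C.Con} (A : C.Ty Γ)
    {x : C.Sub C.emp (C.iCon I (C.aCon Γ))} (a : C.Tm C.emp (C.sTy (C.iTy I (C.aTy A)) x)) :
    φ.restrict f.suc (I := I + 1) (J := J + 1) A (x := x) a = φ.restrict f (C.aTy A) a := by
  -- With `∀Γ ▷ ∀A` generalized to a variable context `X`, the equality can be eliminated, and the
  -- casts then agree by proof irrelevance.
  have key : ∀ (X : C.Con) (h : C.aCon (C.ext Γ A) = X)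
      (hI : C.iCon I X = C.ext (C.iCon I (C.aCon Γ)) (C.iTy I (C.aTy A)))
      (hJ : C.iCon J X = C.ext (C.iCon J (C.aCon Γ)) (C.iTy J (C.aTy A)))
      (hI' : C.iCon I (C.aCon (C.ext Γ A)) = C.ext (C.iCon I (C.aCon Γ)) (C.iTy I (C.aTy A)))
      (hJ' : C.iCon J (C.aCon (C.ext Γ A)) = C.ext (C.iCon J (C.aCon Γ)) (C.iTy J (C.aTy A))),
      cast (congrArg (C.Sub C.emp) hJ') (C.comp (φ.map f (C.aCon (C.ext Γ A)))
        (cast (congrArg (C.Sub C.emp) hI'.symm) (C.pair x a))) =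
      cast (congrArg (C.Sub C.emp) hJ) (C.comp (φ.map f X)
        (cast (congrArg (C.Sub C.emp) hI.symm) (C.pair x a))) := by
    rintro X rfl hI hJ hI' hJ'; rfl
  unfold restrict
  rw [φ.map_suc]
  exact key _ (C.aCon_ext Γ A) (C.iCon_ext I _ _) (C.iCon_ext J _ _)
    (C.iCon_ext (I + 1) Γ A) (C.iCon_ext (J + 1) Γ A)

theorem nerveRes_suc {J I : ℕ} (f : CubeHom J I) {Γ : C.Con} (A : C.Ty Γ)
    {x : C.Sub C.emp (C.iCon I (C.aCon Γ))} {y : C.Sub C.emp (C.iCon J (C.aCon Γ))}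
    (h : C.comp (φ.map f (C.aCon Γ)) x = y) (h' : C.comp (φ.map f.suc Γ) x = y)
    (a : C.Tm C.emp (C.sTy (C.iTy I (C.aTy A)) x)) :
    φ.nerveRes f (C.aTy A) h a = φ.nerveRes f.suc (I := I + 1) (J := J + 1) A h' a :=
  φ.nerveRes_of_eq f (C.aTy A) h a _
    ((φ.restrict_suc f A a).symm.trans (φ.pair_nerveRes f.suc (I := I + 1) A h' a).symm)

theorem nerveTy_aTy {Γ : C.Con} (A : C.Ty Γ) :
    HEq (φ.nerveTy (C.aTy A)) (φ.nerveTy A).all := by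
  refine DepPsh.heq (φ.nerveCon_aCon Γ) ?_ ?_
  · intro I x x' hx
    cases hx; rfl
  · intro J I f x y x' y' h h' a a' hx hy ha
    cases hx; cases hy; cases ha
    exact heq_of_eq (φ.nerveRes_suc f A h h' a)

/-- Passing from `A[σ]` over `x` to `A` over `∀^I σ ∘ x` is composition with `∀^I(σ↑)`, which
commutes with `⌜f⌝` by naturality. -/
theorem nerveRes_sTy {J I : ℕ} (f : CubeHom J I) {Δ Γ : C.Con} (A : C.Ty Γ) (σ : C.Sub Δ Γ)
    {x : C.Sub C.emp (C.iCon I Δ)} {y : C.Sub C.emp (C.iCon J Δ)} (h : C.comp (φ.map f Δ) x = y)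
    (h' : C.comp (φ.map f Γ) (C.comp (C.iSub I σ) x) = C.comp (C.iSub J σ) y)
    (a : C.Tm C.emp (C.sTy (C.iTy I (C.sTy A σ)) x))
    (a' : C.Tm C.emp (C.sTy (C.iTy I A) (C.comp (C.iSub I σ) x))) (ha : HEq a a') :
    HEq (φ.nerveRes f (C.sTy A σ) h a) (φ.nerveRes f A h' a') := by
  let b := C.coe (C.iTy_sTy_sTy J A σ y) (φ.nerveRes f (C.sTy A σ) h a)
  have hb : HEq (φ.nerveRes f (C.sTy A σ) h a) b := (C.coe_heq _ _).symm
  refine hb.trans (heq_of_eq (φ.nerveRes_of_eq f A h' a' b ?_).symm)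
  rw [← C.iOfExt_lift J σ A y _ b hb, φ.pair_nerveRes, restrict, restrict,
    ← C.iOfExt_lift I σ A x a a' ha, C.iToExt_iOfExt, C.iToExt_iOfExt, ← C.assoc, φ.nat, C.assoc]

theorem nerveTy_sTy {Δ Γ : C.Con} (A : C.Ty Γ) (σ : C.Sub Δ Γ) :
    φ.nerveTy (C.sTy A σ) = (φ.nerveTy A).sub (φ.nerveSub σ) := by
  refine eq_of_heq (DepPsh.heq rfl ?_ ?_)
  · intro I x x' hx
    cases hx
    exact congrArg (C.Tm C.emp) (C.iTy_sTy_sTy I A σ x)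
  · intro J I f x y x' y' h h' a a' hx hy ha
    cases hx; cases hy
    exact φ.nerveRes_sTy f A σ h
      ((φ.comp_nat f σ x).symm.trans (congrArg (C.comp (C.iSub J σ)) h)) a a' ha

theorem nerveTm_sTm {Δ Γ : C.Con} {A : C.Ty Γ} (t : C.Tm Γ A) (σ : C.Sub Δ Γ) :
    HEq (φ.nerveTm (C.sTm t σ)) ((φ.nerveTm t).sub (φ.nerveSub σ)) := by
  refine DepPsh.section_heq rfl (heq_of_eq (φ.nerveTy_sTy A σ)) ?_
  intro I x x' hx
  cases hx
  exact (C.sTm_heq (C.iTy_s I A σ) (C.iTm_s I t σ) _).trans (C.sTm_comp _ _ _).symm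

theorem nerveSub_heq {Δ Γ : C.Con} {σ : C.Sub Δ Γ} {Δ' Γ' : Psh.{v}}
    (hΔ : φ.nerveCon Δ = Δ') (hΓ : φ.nerveCon Γ = Γ') {τ : Δ' ⟶ Γ'}
    (h : ∀ (I : ℕ) (x : C.Sub C.emp (C.iCon I Δ)) (y : Δ'.obj (op ⟨I⟩)), HEq x y →
      HEq (C.comp (C.iSub I σ) x) (Psh.ap τ y)) : HEq (φ.nerveSub σ) τ :=
  Psh.hom_heq hΔ hΓ (fun {I} x y hxy => h I x y hxy)

theorem nerveSub_aSub {Δ Γ : C.Con} (σ : C.Sub Δ Γ) :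
    HEq (φ.nerveSub (C.aSub σ)) (PSh.{v}.aSub (φ.nerveSub σ)) := by
  refine φ.nerveSub_heq (φ.nerveCon_aCon Δ) (φ.nerveCon_aCon Γ) ?_
  intro I x y hxy
  cases hxy; rfl

theorem nerveTm_aTm {Γ : C.Con} {A : C.Ty Γ} (t : C.Tm Γ A) :
    HEq (φ.nerveTm (C.aTm t)) (PSh.{v}.aTm (φ.nerveTm t)) := by
  refine DepPsh.section_heq (φ.nerveCon_aCon Γ) (φ.nerveTy_aTy A) ?_
  intro I x y hxy
  cases hxy; rfl

theorem nerveSub_k (e : Fin 2) (Γ : C.Con) :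
    HEq (φ.nerveSub (C.k e Γ)) (PSh.{v}.k e (φ.nerveCon Γ)) := by
  refine φ.nerveSub_heq (φ.nerveCon_aCon Γ) rfl ?_
  intro I x y hxy
  cases hxy
  exact heq_of_eq (congrArg (fun s => C.comp s x) (φ.map_face e I Γ).symm)

theorem nerveSub_R (Γ : C.Con) : HEq (φ.nerveSub (C.R Γ)) (PSh.{v}.R (φ.nerveCon Γ)) := by
  refine φ.nerveSub_heq rfl (φ.nerveCon_aCon Γ) ?_
  intro I x y hxy
  cases hxy
  exact heq_of_eq (congrArg (fun s => C.comp s x) (φ.map_deg I Γ).symm)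

theorem nerveSub_S (Γ : C.Con) : HEq (φ.nerveSub (C.S Γ)) (PSh.{v}.S (φ.nerveCon Γ)) := by
  -- Source and target of `S` both involve two index shifts.
  have h : φ.nerveCon (C.aCon (C.aCon Γ)) = Psh.all (Psh.all (φ.nerveCon Γ)) :=
    (φ.nerveCon_aCon _).trans (congrArg Psh.all (φ.nerveCon_aCon Γ))
  refine φ.nerveSub_heq h h ?_
  intro I x y hxy
  cases hxy
  exact heq_of_eq (congrArg (fun s => C.comp s x) (φ.map_sym I Γ).symm)

/-! ### Invertibility of the comparison maps. -/

/-- The inverse of the comparison map for the empty context. -/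
def nerveEmpInv : Psh.unit.{v} ⟶ φ.nerveCon C.emp :=
  Psh.mkHom (fun {I} _ => cast (congrArg (C.Sub C.emp) (C.iCon_emp I).symm) (C.eps C.emp))
    (fun {J _} _ _ => C.sub_iCon_emp_eq J _ _)

theorem iToExt_pair_res {J I : ℕ} (f : CubeHom J I) {Γ : C.Con} (A : C.Ty Γ)
    {x : C.Sub C.emp (C.iCon I Γ)} {y : C.Sub C.emp (C.iCon J Γ)} (h : C.comp (φ.map f Γ) x = y)
    (a : C.Tm C.emp (C.sTy (C.iTy I A) x)) :
    C.iToExt J (C.pair y (φ.nerveRes f A h a)) =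
      C.comp (φ.map f (C.ext Γ A)) (C.iToExt I (C.pair x a)) := by
  rw [φ.pair_nerveRes, restrict, C.iToExt_iOfExt]

/-- The inverse of the comparison map for context extension. -/
def nerveExtInv (Γ : C.Con) (A : C.Ty Γ) : (φ.nerveTy A).total ⟶ φ.nerveCon (C.ext Γ A) :=
  Psh.mkHom
    (fun {I} (z : Σ x : C.Sub C.emp (C.iCon I Γ), C.Tm C.emp (C.sTy (C.iTy I A) x)) =>
      C.iToExt I (C.pair z.1 z.2))
    (fun z f => φ.iToExt_pair_res f A rfl z.2)

/-- The comparison map for context extension. -/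
def nerveExt (Γ : C.Con) (A : C.Ty Γ) : φ.nerveCon (C.ext Γ A) ⟶ (φ.nerveTy A).total :=
  PSh.{v}.pair (φ.nerveSub (C.p A)) (PSh.{v}.coe (φ.nerveTy_sTy A (C.p A)) (φ.nerveTm (C.q A)))

theorem nerveExtInv_nerveExt (Γ : C.Con) (A : C.Ty Γ)
    {I : ℕ} (τ : C.Sub C.emp (C.iCon I (C.ext Γ A))) :
    Psh.ap (φ.nerveExtInv Γ A) (Psh.ap (φ.nerveExt Γ A) (I := I) τ) = τ :=
  C.pair_comparison I A τ _
    (DepPsh.section_coe_app (φ.nerveTy_sTy A (C.p A)) (φ.nerveTm (C.q A)) τ)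

/-- The candidate inverse is injective, so its being a left inverse of the comparison map makes it a
right inverse too. -/
theorem nerveExt_nerveExtInv (Γ : C.Con) (A : C.Ty Γ) {I : ℕ}
    (z : Σ x : C.Sub C.emp (C.iCon I Γ), C.Tm C.emp (C.sTy (C.iTy I A) x)) :
    Psh.ap (φ.nerveExt Γ A) (Psh.ap (φ.nerveExtInv Γ A) (I := I) z) = z := by
  apply C.sigma_tm_ext
  have h := φ.nerveExtInv_nerveExt Γ A (Psh.ap (φ.nerveExtInv Γ A) (I := I) z)
  exact (C.iOfExt_iToExt I _).symm.trans ((congrArg (C.iOfExt I) h).trans (C.iOfExt_iToExt I _))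

/-! ### Assembly of the weak morphism. -/

/-- The global section functor is a weak morphism. -/
def nerveMorphism : WeakMorphism C PSh.{v} where
  toMorphismData := φ.nerve
  sub_comp σ ρ := Psh.hom_ext (fun {I} x =>
    (congrArg (fun s => C.comp s x) (C.iSub_comp I σ ρ)).trans (C.assoc _ _ _))
  sub_id Γ := Psh.hom_ext (fun {I} x =>
    (congrArg (fun s => C.comp s x) (C.iSub_id I Γ)).trans (C.id_comp _))
  ty_s A σ := φ.nerveTy_sTy A σ
  tm_s t σ := φ.nerveTm_sTm t σ
  empInv := φ.nerveEmpInv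
  empInv_eps := Psh.hom_ext (fun {I} _ => C.sub_iCon_emp_eq I _ _)
  extInv := φ.nerveExtInv
  extInv_pair Γ A := Psh.hom_ext (fun τ => φ.nerveExtInv_nerveExt Γ A τ)
  pair_extInv Γ A := Psh.hom_ext (fun z => φ.nerveExt_nerveExtInv Γ A z)
  con_all := φ.nerveCon_aCon
  sub_all := φ.nerveSub_aSub
  ty_all := φ.nerveTy_aTy
  tm_all := φ.nerveTm_aTm
  sub_k := φ.nerveSub_k
  sub_R := φ.nerveSub_R
  sub_S := φ.nerveSub_S

end CubeInterpretation

end IntParam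

theorem mainTheorem5 {L : Type} [SemilatticeSup L] [OrderBot L] {next : L → L}
    (C : IntParam.GlobalModel.{u, v} L next) :
    ∃ (φ : IntParam.CubeInterpretation C.toForallCwF)
      (G : IntParam.WeakMorphism C.toForallCwF IntParam.PSh.{v}),
      G.toMorphismData = φ.nerve :=
  ⟨IntParam.cubeInterpretation C.toForallCwF,
    (IntParam.cubeInterpretation C.toForallCwF).nerveMorphism, rfl⟩
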